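/- **Component encoders and transfer functions.** A systematic convolutional encoder over $\mathbb F_2$ of rate $k/(k+1)$ has the parity sequence $v=\sum_{j=1}^k \frac{n_j(D)}{d(D)}u_j$ with polynomials $n_j,d\in\mathbb F_2[D]$, $d(0)=1$; it is recursive if some $n_j/d$ is not a polynomial. For $p\in[0,1]^{k+1}$ let $f_l(p_1,\dots,p_{k+1})$ be the transfer function of its BCJR decoder on the BEC: the extrinsic erasure probability of the $l$-th code bit of a trellis section when the $i$-th code bits of the sections are erased independently with probability $p_i$. That is, $f_l=\pi_\alpha T_l\pi_\beta$, where $\pi_\alpha,\pi_\beta$ are the steady-state laws of the forward and backward metrics (all-zero codeword sent, trellis started and terminated in the zero state, in the limit of infinite length) and $T_l$ contains the probabilities that the extrinsic output on bit $l$ is an erasure given the two metrics. Let $C$ be a recursive encoder of rate $1/2$, with transfer functions $f_{\rm s},f_{\rm p}$ for the systematic and the parity bit, and let $B$ be a recursive encoder of rate $2/3$, with transfer functions $f_1,f_2,f_3$ and $f_{\rm ave}=(f_1+f_2+f_3)/3$. The time-varying version of $B$ places the three code bits of every trellis section on its three edges in an independent, uniformly random order; its transfer functions are denoted $\hat f_1,\hat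 f_2,\hat f_3$. **Scalar systems.** For $f:[0,1]^2\to[0,1]$ and $g:[0,1]\to[0,1]$ put $$U(x;\varepsilon)=xg(x)-\int_0^x g(z)\,dz-\int_0^{g(x)}f(z;\varepsilon)\,dz,\qquad u(\varepsilon)=\sup\{\tilde x\in[0,1]: f(g(x);\varepsilon)<x\ \ \forall x\in(0,\tilde x)\},$$ $$\varepsilon^*(f,g)=\sup\{\varepsilon\in[0,1]: u(\varepsilon)>0,\ U(x;\varepsilon)>0\ \ \forall x\in[u(\varepsilon),1]\}$$ (with $\sup\emptyset=0$). For a memory $m\ge0$ and lengths $L,M\ge 0$ the coupled recursion is $$x_t^{(i+1)}=\frac1{1+m}\sum_{j=0}^m f_{t+j}\Big(\frac1{1+m}\sum_{k=0}^m g\big(x^{(i)}_{t+j-k}\big);\varepsilon\Big)\quad(1\le t\le L),\qquad x_t^{(i+1)}=0\quad(t\in\mathbb Z\setminus\{1,\dots,L\}),\tag{R}$$ where $f_t=f$ for $1\le t\le M$ and $f_t=0$ otherwise. **Coupled density evolution.** The chain has length $L$: symbols of times $1,\dots,L$ are transmitted, all symbols of other times are known zeros. For an erasure probability $e$ put $e_t=e$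 for $1\le t\le L$ and $e_t=0$ otherwise. Write $(Aa)_t=\frac1{m+1}\sum_{j=0}^m a_{t+j}$ and $(A^*a)_t=\frac1{m+1}\sum_{k=0}^m a_{t-k}$. All messages are $1$ in iteration $0$. * SC-PCC (erasure probabilities $e$ of information bits, $e'$ of parity bits; both encoders equal to $C$): for $\{c,c'\}=\{\mathrm U,\mathrm L\}$, $\bar q_{c}^{(i)}=A\,p_{c,{\rm s}}^{(i)}$ and $p_{c,{\rm s}}^{(i+1,t)}=f_{\rm s}\big((A^*(e\,\bar q_{c'}^{(i)}))_t,\,e'_t\big)$, where $(e\,\bar q)_t=e_t\bar q_t$ (and likewise $p_{c,{\rm p}}$ with $f_{\rm p}$). * SC-SCC (erasure probabilities $e,e',e''$ of information, outer parity and inner parity bits; both encoders equal to $C$): $q_{\rm I}^{(i+1,t)}=e_t(A\,p_{\rm I,s}^{(i)})_t$, $\tilde q_{\rm I}^{(i+1,t)}=e'_t(A\,p_{\rm I,s}^{(i)})_t$, $p_{\rm O,s}^{(i+1,t)}=f_{\rm s}(q_{\rm I}^{(i+1,t)},\tilde q_{\rm I}^{(i+1,t)})$, $p_{\rm O,p}^{(i+1,t)}=f_{\rm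 p}(q_{\rm I}^{(i+1,t)},\tilde q_{\rm I}^{(i+1,t)})$, $q_{\rm O}^{(i+1)}=A^*\big(\tfrac12(e\,p_{\rm O,s}^{(i+1)}+e'\,p_{\rm O,p}^{(i+1)})\big)$, $p_{\rm I,s}^{(i+1,t)}=f_{\rm s}(q_{\rm O}^{(i+1,t)},e''_t)$ (and likewise $p_{\rm I,p}$ with $f_{\rm p}$). * Modified SC-BCC (erasure probability $e$ of all bits; both encoders equal to the time-varying version of $B$; every edge of a time-$t$ factor node is coupled uniformly to variable nodes of times $t-m,\dots,t$, and every variable node of time $t$ to factor nodes of times $t,\dots,t+m$): $\bar q_{c,a}^{(i)}=A\,p_{c,a}^{(i)}$ and $p_{c,a}^{(i+1,t)}=\hat f_a\big((A^*(e\,\bar q_{c',1}^{(i)}))_t,(A^*(e\,\bar q_{c',3}^{(i)}))_t,(A^*(e\,\bar q_{c',2}^{(i)}))_t\big)$ for $a=1,2,3$. For $\rho\in[0,1]$ put $\varepsilon_\rho=1-(1-\varepsilon)\rho$. **Theorem.** In each of the following cases: 1. SC-PCC, $(e,e')=(\varepsilon,\varepsilon)$: $f(y;\varepsilon)=f_{\rm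 s}(\varepsilon y,\varepsilon)$, $g(x)=x$; 2. SC-SCC, $(e,e',e'')=(\varepsilon,\varepsilon,\varepsilon)$: $f(y;\varepsilon)=\varepsilon f_{\rm s}(\varepsilon y,\varepsilon)$, $g(x)=\frac12(f_{\rm s}(x,x)+f_{\rm p}(x,x))$; 3. modified SC-BCC, $e=\varepsilon$: $f(y;\varepsilon)=f_{\rm ave}(\varepsilon y,\varepsilon y,\varepsilon y)$, $g(x)=x$; 4. punctured SC-PCC, $(e,e')=(\varepsilon,\varepsilon_\rho)$, any $\rho\in[0,1]$: $f(y;\varepsilon)=f_{\rm s}(\varepsilon y,\varepsilon_\rho)$, $g(x)=x$; 5. punctured SC-SCC, $(e,e',e'')=(\varepsilon_{\rho_1},\varepsilon_{\rho_1},\varepsilon_{\rho_2})$, any $\rho_1,\rho_2\in[0,1]$: $f(y;\varepsilon)=\varepsilon_{\rho_1}f_{\rm s}(\varepsilon_{\rho_1}y,\varepsilon_{\rho_2})$, $g$ as in 2; 6. punctured modified SC-BCC, $e=\varepsilon_\rho$, any $\rho\in[0,1]$: $f(y;\varepsilon)=f_{\rm ave}(\varepsilon_\rho y,\varepsilon_\rho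 y,\varepsilon_\rho y)$, $g(x)=x$; the following holds. (a) *Reduction.* For all $\varepsilon\in[0,1]$, $m$, $L$ and all iterations, the density evolution is symmetric ($\bar q_{\rm U}=\bar q_{\rm L}$ for PCCs; all $\bar q_{c,a}$ equal for BCCs), and the sequence $x_t^{(i)}$ given for $1\le t\le L$ by $\bar q_{\rm U}^{(i,t)}$ (PCC), by $q_{\rm I}^{(i+1,t)}$ (SCC), by $\bar q_{{\rm U},1}^{(i,t)}$ (BCC), and by $0$ for all other $t$, satisfies the recursion (R), with $M=L$ for PCCs and SCCs and $M=L+m$ for BCCs. (b) *Threshold saturation.* For every $\varepsilon\in[0,1]$ with $\varepsilon<\varepsilon^*(f,g)$ there is $m_0$ such that for all $m\ge m_0$ and all $L,M\ge0$, the only fixed point of (R) with values $x_t\in[0,1]$ is $x=0$. -/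

import Mathlib

namespace SCTurbo

noncomputable section

/-! ## Systematic convolutional encoders and the BCJR transfer functions on the BEC -/

/-- A systematic convolutional encoder over `GF(2)` with `k` inputs and one parity output, i.e. of
rate `k / (k + 1)`.  The parity sequence is `v = ∑ j, (feedforward j / feedback) * u j`, as formal
series in the delay `D`; code bit `l < k` is the `l`-th input, code bit `k` is the parity bit. -/
structure SystematicEncoder (k : ℕ) where
  feedback : Polynomial (ZMod 2)
  feedforward : Fin k → Polynomial (ZMod 2)
  feedback_coeff_zero : feedback.coeff 0 = 1

namespace SystematicEncoder

variable {k : ℕ} (C : SystematicEncoder k)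

/-- The encoder is recursive: its generator matrix is not polynomial. -/
def IsRecursive : Prop := ∃ j, ¬ C.feedback ∣ C.feedforward j

/-- The memory of the encoder. -/
def memory : ℕ := max C.feedback.natDegree (Finset.univ.sup fun j => (C.feedforward j).natDegree)

/-- The `2 ^ memory` trellis states. -/
abbrev State : Type := Fin C.memory → ZMod 2

/-- The `i`-th register of the state, `0` beyond the last one. -/
def register (s : C.State) (i : ℕ) : ZMod 2 := if h : i < C.memory then s ⟨i, h⟩ else 0

/-- The parity bit of the trellis edge leaving state `s` with input `u`
(observer canonical form). -/
def parity (s : C.State) (u : Fin k → ZMod 2) : ZMod 2 :=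
  C.register s 0 + ∑ j, (C.feedforward j).coeff 0 * u j

/-- The end state of the trellis edge leaving state `s` with input `u`
(observer canonical form). -/
def nextState (s : C.State) (u : Fin k → ZMod 2) : C.State := fun i =>
  C.register s (i + 1) + ∑ j, (C.feedforward j).coeff (i + 1) * u j
    + C.feedback.coeff (i + 1) * C.parity s u

/-- The `k + 1` code bits of the trellis edge leaving state `s` with input `u`. -/
def label (s : C.State) (u : Fin k → ZMod 2) : Fin (k + 1) → ZMod 2 := Fin.snoc u (C.parity s u)

/-- The all-zero codeword is sent.  If `E` is the set of erased code bits of a trellis section, the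
branch metric of an edge is nonzero iff its label vanishes outside `E`. -/
def Compatible (E : Finset (Fin (k + 1))) (s : C.State) (u : Fin k → ZMod 2) : Prop :=
  ∀ l, l ∉ E → C.label s u l = 0

/-- One step of the forward recursion.  On the BEC the nonzero entries of a metric vector are all
equal, so the vector is given by its support, a set of states. -/
def forwardStep (E : Finset (Fin (k + 1))) (A : Set C.State) : Set C.State :=
  {s' | ∃ s ∈ A, ∃ u, C.Compatible E s u ∧ C.nextState s u = s'}

/-- One step of the backward recursion. -/
def backwardStep (E : Finset (Fin (k + 1))) (B : Set C.State) : Set C.State :=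
  {s | ∃ u, C.Compatible E s u ∧ C.nextState s u ∈ B}

open Classical in
/-- Transition matrix of the Markov chain of forward metrics, if the sets of erased bits of the
trellis sections are independent with law `μ`. -/
def forwardMatrix (μ : Finset (Fin (k + 1)) → ℝ) : Matrix (Set C.State) (Set C.State) ℝ :=
  fun A A' => ∑ E, if C.forwardStep E A = A' then μ E else 0

open Classical in
/-- Transition matrix of the Markov chain of backward metrics. -/
def backwardMatrix (μ : Finset (Fin (k + 1)) → ℝ) : Matrix (Set C.State) (Set C.State) ℝ :=
  fun B B' => ∑ E, if C.backwardStep E B = B' then μ E else 0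

open Classical in
/-- Steady-state distribution of the forward metrics: the limit law of the chain that starts in the
known zero state.  (The law is stochastically increasing in the number of steps, so it
converges.) -/
def forwardSteady (μ : Finset (Fin (k + 1)) → ℝ) (A : Set C.State) : ℝ :=
  Filter.atTop.limUnder fun N : ℕ => (C.forwardMatrix μ ^ N) {0} A

open Classical in
/-- Steady-state distribution of the backward metrics, for a trellis that ends in the zero state. -/
def backwardSteady (μ : Finset (Fin (k + 1)) → ℝ) (B : Set C.State) : ℝ :=
  Filter.atTop.limUnder fun N : ℕ => (C.backwardMatrix μ ^ N) {0} B

/-- The extrinsic output on the `l`-th code bit of a section is an erasure: the value `1` of this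
bit is compatible with the metrics `A`, `B` and with the other bits of the section (the value `0`,
which has been sent, always is). -/
def ExtrinsicErased (l : Fin (k + 1)) (E : Finset (Fin (k + 1))) (A B : Set C.State) : Prop :=
  ∃ s ∈ A, ∃ u, C.Compatible (insert l E) s u ∧ C.label s u l = 1 ∧ C.nextState s u ∈ B

open Classical in
/-- The matrix `T_l`: probability that the extrinsic output on bit `l` is an erasure, given the
forward and backward metrics. -/
def erasureMatrix (μ : Finset (Fin (k + 1)) → ℝ) (l : Fin (k + 1)) :
    Matrix (Set C.State) (Set C.State) ℝ :=
  fun A B => ∑ E, if C.ExtrinsicErased l E A B then μ E else 0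

/-- Law of the set of erased bits of a section, the `l`-th code bit being erased with probability
`p l`, independently of the others. -/
def sectionLaw (p : Fin (k + 1) → ℝ) (E : Finset (Fin (k + 1))) : ℝ :=
  ∏ l, if l ∈ E then p l else 1 - p l

/-- Transfer function `f_l (p_1, …, p_n)` of the BCJR decoder: the extrinsic erasure probability
of the `l`-th code bit, `π_α T_l π_β`. -/
def transfer (l : Fin (k + 1)) (p : Fin (k + 1) → ℝ) : ℝ :=
  ∑ A, ∑ B, C.forwardSteady (sectionLaw p) A * C.erasureMatrix (sectionLaw p) l A B
    * C.backwardSteady (sectionLaw p) B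

/-- Law of the erased code bits of a section of the time-varying trellis: the code bits are put on
the `k + 1` edges in a uniformly random order, code bit `l` on edge `σ l`, and the symbols on
edge `a` are erased with probability `p a`. -/
def mixedLaw (p : Fin (k + 1) → ℝ) (E : Finset (Fin (k + 1))) : ℝ :=
  (∑ σ : Equiv.Perm (Fin (k + 1)), sectionLaw (fun l => p (σ l)) E) / (Nat.factorial (k + 1) : ℝ)

/-- Transfer function of the time-varying trellis for its edge `a`; with the order `σ` this edge
carries code bit `σ⁻¹ a`.  The orders of different sections are independent. -/
def mixedTransfer (a : Fin (k + 1)) (p : Fin (k + 1) → ℝ) : ℝ :=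
  ∑ A, ∑ B, C.forwardSteady (mixedLaw p) A
    * ((∑ σ : Equiv.Perm (Fin (k + 1)),
          C.erasureMatrix (sectionLaw fun l => p (σ l)) (σ⁻¹ a) A B)
        / (Nat.factorial (k + 1) : ℝ))
    * C.backwardSteady (mixedLaw p) B

/-- The average `f_ave` of the transfer functions of the fixed trellis. -/
def averageTransfer (p : Fin (k + 1) → ℝ) : ℝ := (∑ l, C.transfer l p) / ((k : ℝ) + 1)

end SystematicEncoder

/-! ## Coupled density evolution -/

/-- `(1 / (m+1)) ∑_{j=0}^m a (t + j)`. -/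
def forwardAvg (m : ℕ) (a : ℤ → ℝ) (t : ℤ) : ℝ :=
  (1 / ((m : ℝ) + 1)) * ∑ j ∈ Finset.range (m + 1), a (t + j)

/-- `(1 / (m+1)) ∑_{k=0}^m a (t - k)`. -/
def backwardAvg (m : ℕ) (a : ℤ → ℝ) (t : ℤ) : ℝ :=
  (1 / ((m : ℝ) + 1)) * ∑ k ∈ Finset.range (m + 1), a (t - k)

/-- Restriction to the times `1, …, L` of the chain.  In particular `onChain L fun _ => e` is the
erasure profile of symbols that are sent at times `1, …, L` over a BEC(`e`) and are known zeros at
all other times. -/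
def onChain (L : ℕ) (a : ℤ → ℝ) (t : ℤ) : ℝ := if 1 ≤ t ∧ t ≤ (L : ℤ) then a t else 0

/-- Erasure probability of a BEC(`ε`) after random puncturing with permeability rate `ρ`. -/
def puncture (ρ ε : ℝ) : ℝ := 1 - (1 - ε) * ρ

/-- The two component encoders of a PCC or a BCC. -/
inductive Component where
  | upper
  | lower

/-- Swap the two components. -/
def Component.other : Component → Component
  | .upper => .lower
  | .lower => .upper

/-- Density evolution of the SC-PCC with coupling memory `m`, coupling length `L`, erasure
probability `e₀` on the information bits and `e₁` on the parity bits: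
`pccMessage … i c l t` is the extrinsic erasure probability in iteration `i` from factor node
`T^c_t` to its systematic (`l = 0`) or parity (`l = 1`) bits. -/
def pccMessage (C : Component → SystematicEncoder 1) (m L : ℕ) (e₀ e₁ : ℝ) :
    ℕ → Component → Fin 2 → ℤ → ℝ
  | 0 => fun _ _ _ => 1
  | i + 1 => fun c l t =>
      (C c).transfer l
        ![backwardAvg m (fun r => onChain L (fun _ => e₀) r
            * forwardAvg m (pccMessage C m L e₀ e₁ i c.other 0) r) t,
          onChain L (fun _ => e₁) t]

/-- Average erasure probability `q̄` from the factor nodes of component `c` to `u_t`. -/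
def pccToInfo (C : Component → SystematicEncoder 1) (m L : ℕ) (e₀ e₁ : ℝ)
    (i : ℕ) (c : Component) : ℤ → ℝ :=
  forwardAvg m (pccMessage C m L e₀ e₁ i c 0)

/-- One outer update of the SC-SCC: from the inner messages `a t` (to the systematic bits) of the
previous iteration to the outer messages `p_O` of factor node `T^O_t`. -/
def sccOuter (CO : SystematicEncoder 1) (m L : ℕ) (e₀ e₁ : ℝ) (a : ℤ → ℝ)
    (l : Fin 2) (t : ℤ) : ℝ :=
  CO.transfer l
    ![onChain L (fun _ => e₀) t * forwardAvg m a t, onChain L (fun _ => e₁) t * forwardAvg m a t]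

/-- Density evolution of the SC-SCC with outer encoder `CO` and inner encoder `CI`, and erasure
probabilities `e₀` on the information bits, `e₁` on the outer parity bits and `e₂` on the inner
parity bits: `sccInner … i l t` is the message in iteration `i` from factor node `T^I_t` to its
systematic (`l = 0`) or parity (`l = 1`) bits. -/
def sccInner (CO CI : SystematicEncoder 1) (m L : ℕ) (e₀ e₁ e₂ : ℝ) : ℕ → Fin 2 → ℤ → ℝ
  | 0 => fun _ _ => 1
  | i + 1 => fun l t =>
      CI.transfer l
        ![backwardAvg m (fun r =>
            (onChain L (fun _ => e₀) r
                * sccOuter CO m L e₀ e₁ (sccInner CO CI m L e₀ e₁ e₂ i 0) 0 r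
              + onChain L (fun _ => e₁) r
                * sccOuter CO m L e₀ e₁ (sccInner CO CI m L e₀ e₁ e₂ i 0) 1 r) / 2) t,
          onChain L (fun _ => e₂) t]

/-- The erasure probability `q_I` from `u_t` to `T^O_t` in iteration `i + 1`. -/
def sccToOuter (CO CI : SystematicEncoder 1) (m L : ℕ) (e₀ e₁ e₂ : ℝ) (i : ℕ) (t : ℤ) : ℝ :=
  onChain L (fun _ => e₀) t * forwardAvg m (sccInner CO CI m L e₀ e₁ e₂ i 0) t

/-- The edges of a BCC: the symbols on edge `0` (information) of one component are on edge `0` of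
the other one; the second input (edge `1`) of one component is the parity (edge `2`) of the
other. -/
def bccEdge : Fin 3 → Fin 3 := ![0, 2, 1]

/-- Density evolution of the modified coupled BCC ensemble with time-varying trellises, all symbols
being sent over a BEC(`e`).  All three symbol sequences of time `t` are spread uniformly over
the times `t, …, t + m`: the edges of the factor nodes at time `t` are connected to variable nodes
of times `t - m, …, t`, and each variable node of time `t` to factor nodes of times
`t, …, t + m`.  `bccMessage … i c a t` is the message from factor node `T^c_t` through edge `a`. -/
def bccMessage (C : Component → SystematicEncoder 2) (m L : ℕ) (e : ℝ) :
    ℕ → Component → Fin 3 → ℤ → ℝ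
  | 0 => fun _ _ _ => 1
  | i + 1 => fun c a t =>
      (C c).mixedTransfer a fun b =>
        backwardAvg m (fun r => onChain L (fun _ => e) r
          * forwardAvg m (bccMessage C m L e i c.other (bccEdge b)) r) t

/-- Average erasure probability from the edges `a` of the factor nodes of component `c` to the
variable nodes of time `t` connected to them. -/
def bccToSymbol (C : Component → SystematicEncoder 2) (m L : ℕ) (e : ℝ)
    (i : ℕ) (c : Component) (a : Fin 3) : ℤ → ℝ :=
  forwardAvg m (bccMessage C m L e i c a)

/-! ## Scalar systems, potential threshold, scalar coupled recursion -/

/-- The potential function `U(x; ε) = x g(x) - G(x) - F(g(x); ε)` of the scalar recursion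
`x ↦ f(g(x); ε)`. -/
def potential (f : ℝ → ℝ → ℝ) (g : ℝ → ℝ) (x ε : ℝ) : ℝ :=
  x * g x - (∫ z in (0 : ℝ)..x, g z) - ∫ z in (0 : ℝ)..(g x), f z ε

/-- The minimum unstable fixed point `u(ε)`. -/
def minUnstable (f : ℝ → ℝ → ℝ) (g : ℝ → ℝ) (ε : ℝ) : ℝ :=
  sSup {y | y ∈ Set.Icc (0 : ℝ) 1 ∧ ∀ x ∈ Set.Ioo 0 y, f (g x) ε < x}

/-- The potential threshold `ε*`. -/
def potentialThreshold (f : ℝ → ℝ → ℝ) (g : ℝ → ℝ) : ℝ :=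
  sSup {ε | ε ∈ Set.Icc (0 : ℝ) 1 ∧ 0 < minUnstable f g ε ∧
    ∀ x ∈ Set.Icc (minUnstable f g ε) 1, 0 < potential f g x ε}

/-- One iteration of the scalar coupled recursion
`x_t ← (1/(m+1)) ∑_j f_{t+j} ((1/(m+1)) ∑_k g (x_{t+j-k}); ε)` on a terminated chain:
`x_t` is updated at the times `1, …, L` and is `0` at all other times; `f_t = f` for
`1 ≤ t ≤ M` and `f_t = 0` for all other `t`. -/
def coupledStep (f : ℝ → ℝ → ℝ) (g : ℝ → ℝ) (ε : ℝ) (m L M : ℕ) (x : ℤ → ℝ) : ℤ → ℝ :=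
  onChain L (forwardAvg m (onChain M fun s => f (backwardAvg m (fun r => g (x r)) s) ε))

/-- Threshold saturation of the system `(f, g)`: below the potential threshold and for large enough
coupling memory, `0` is the only fixed point of the coupled recursion, for all chain lengths. -/
def ThresholdSaturation (f : ℝ → ℝ → ℝ) (g : ℝ → ℝ) : Prop :=
  ∀ ε ∈ Set.Icc (0 : ℝ) 1, ε < potentialThreshold f g →
    ∃ m₀ : ℕ, ∀ m ≥ m₀, ∀ L M : ℕ, ∀ x : ℤ → ℝ, (∀ t, x t ∈ Set.Icc (0 : ℝ) 1) →
      (coupledStep f g ε m L M x = x ↔ x = 0)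

end

end SCTurbo

open SCTurbo

namespace SCTurbo

open Set

/-! The theorem has two sources: a potential argument for abstract monotone systems, and facts about
the BCJR transfer functions that put every ensemble into that setting.

Potential argument (`potential_le_of_le_step`, `thresholdSaturation_of_monotone`). The running
maximum `X` of a fixed point is a monotone profile rising from 0 to some `ξ`, and it satisfies `X ≤
A φ(A* g(X))`. Sum this inequality against the increments of `g(X)`. The left side telescopes to at
least `ξ g(ξ) - ∫ g`. On the right, summation by parts moves `A` onto `g(X)`, which leaves a Riemann
sum of `φ` along `z = A* g(X)`; its mesh is at most `1/(m+1)`, since consecutive windows of length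
`m+1` differ in one term. Hence the potential at `ξ` is at most `1/(m+1)`, uniformly in the chain
length. On the other hand `ξ ≤ φ(g(ξ))`, so either `ξ = 0` or `ξ` lies in the region `[u, 1]` where
the potential has a positive minimum. For large `m` only `ξ = 0` survives. This needs `f` monotone
in both arguments, and `g` monotone and continuous with `g 0 = 0`.

Transfer functions. The forward and backward metrics are Markov chains of monotone maps on sets of
states. Stochastic monotonicity gives existence of the steady states and monotonicity of the
transfer functions. Continuity of the diagonal `x ↦ f_l(x, …, x)` follows by squeezing it between
truncated trellises with known and with unknown end states, which agree in the limit by a Doeblin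
bound.

Reduction. Outside the chain the messages of PCCs and SCCs vanish because `f_s(x, 0) = 0` for a
recursive encoder; this is an argument with power series in the delay. For BCCs the random order of
the code bits makes all edges equivalent, and its transfer function at equal arguments is `f_ave`.
-/

@[simp]
theorem onChain_zero (L : ℕ) : onChain L (fun _ => 0) = fun _ => 0 := by
  funext t
  simp [onChain]

/-! ### Window averages. -/

section Averages

variable {m : ℕ} {a b : ℤ → ℝ} {t : ℤ}

theorem forwardAvg_mono (h : ∀ j ≤ m, a (t + j) ≤ b (t + j)) :
    forwardAvg m a t ≤ forwardAvg m b t := by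
  unfold forwardAvg
  refine mul_le_mul_of_nonneg_left (Finset.sum_le_sum fun j hj => h j ?_) (by positivity)
  exact Nat.lt_succ_iff.mp (Finset.mem_range.mp hj)

theorem backwardAvg_mono (h : ∀ j ≤ m, a (t - j) ≤ b (t - j)) :
    backwardAvg m a t ≤ backwardAvg m b t := by
  unfold backwardAvg
  refine mul_le_mul_of_nonneg_left (Finset.sum_le_sum fun j hj => h j ?_) (by positivity)
  exact Nat.lt_succ_iff.mp (Finset.mem_range.mp hj)

theorem forwardAvg_congr (h : ∀ j ≤ m, a (t + j) = b (t + j)) :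
    forwardAvg m a t = forwardAvg m b t :=
  le_antisymm (forwardAvg_mono fun j hj => (h j hj).le) (forwardAvg_mono fun j hj => (h j hj).ge)

theorem backwardAvg_congr (h : ∀ j ≤ m, a (t - j) = b (t - j)) :
    backwardAvg m a t = backwardAvg m b t :=
  le_antisymm (backwardAvg_mono fun j hj => (h j hj).le) (backwardAvg_mono fun j hj => (h j hj).ge)

theorem forwardAvg_const (c : ℝ) : forwardAvg m (fun _ => c) t = c := by
  have : (m : ℝ) + 1 ≠ 0 := by positivity
  simp [forwardAvg]
  field_simp

theorem backwardAvg_const (c : ℝ) : backwardAvg m (fun _ => c) t = c := by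
  have : (m : ℝ) + 1 ≠ 0 := by positivity
  simp [backwardAvg]
  field_simp

theorem backwardAvg_const_mul (c : ℝ) :
    backwardAvg m (fun r => c * a r) t = c * backwardAvg m a t := by
  simp only [backwardAvg, ← Finset.mul_sum]
  ring

theorem forwardAvg_const_mul (c : ℝ) :
    forwardAvg m (fun r => c * a r) t = c * forwardAvg m a t := by
  simp only [forwardAvg, ← Finset.mul_sum]
  ring

theorem backwardAvg_mem_Icc (h : ∀ r, a r ∈ Icc (0 : ℝ) 1) :
    backwardAvg m a t ∈ Icc (0 : ℝ) 1 :=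
  ⟨(backwardAvg_const (m := m) (t := t) (0 : ℝ)).symm.le.trans
      (backwardAvg_mono fun _ _ => (h _).1),
    (backwardAvg_mono fun _ _ => (h _).2).trans (backwardAvg_const (m := m) (t := t) 1).le⟩

theorem forwardAvg_mem_Icc (h : ∀ r, a r ∈ Icc (0 : ℝ) 1) :
    forwardAvg m a t ∈ Icc (0 : ℝ) 1 :=
  ⟨(forwardAvg_const (m := m) (t := t) (0 : ℝ)).symm.le.trans
      (forwardAvg_mono fun _ _ => (h _).1),
    (forwardAvg_mono fun _ _ => (h _).2).trans (forwardAvg_const (m := m) (t := t) 1).le⟩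

end Averages

/-! ### The potential inequality for monotone profiles. -/

section Potential

variable {φ g : ℝ → ℝ}

theorem _root_.MonotoneOn.intervalIntegrable_of_mem {a b : ℝ} (hφ : MonotoneOn φ (Icc 0 1))
    (ha : a ∈ Icc (0 : ℝ) 1) (hb : b ∈ Icc (0 : ℝ) 1) :
    IntervalIntegrable φ MeasureTheory.volume a b :=
  (hφ.mono (uIcc_subset_Icc ha hb)).intervalIntegrable

/-- A monotone function lies above its value at the left end of an interval of integration. -/
theorem _root_.MonotoneOn.mul_sub_le_integral {a b : ℝ} (hφ : MonotoneOn φ (Icc 0 1))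
    (ha : a ∈ Icc (0 : ℝ) 1) (hb : b ∈ Icc (0 : ℝ) 1) (hab : a ≤ b) :
    φ a * (b - a) ≤ (∫ z in (0 : ℝ)..b, φ z) - ∫ z in (0 : ℝ)..a, φ z := by
  have h0 : (0 : ℝ) ∈ Icc (0 : ℝ) 1 := by simp
  rw [intervalIntegral.integral_interval_sub_left (hφ.intervalIntegrable_of_mem h0 hb)
    (hφ.intervalIntegrable_of_mem h0 ha)]
  have := intervalIntegral.integral_mono_on (μ := MeasureTheory.volume) hab
    (intervalIntegrable_const (c := φ a)) (hφ.intervalIntegrable_of_mem ha hb)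
    fun x hx => hφ ha ⟨ha.1.trans hx.1, hx.2.trans hb.2⟩ hx.1
  simpa [mul_comm] using this

/-- Summation by parts against a monotone profile `X` that is `0` up to time `0` and constant from
time `L` on. -/
theorem sum_forwardAvg_mul_sub {m L : ℕ} {y G : ℤ → ℝ} {c : ℝ} (h0 : ∀ t ≤ 0, G t = 0)
    (hL : ∀ t ≥ (L : ℤ), G t = c) :
    ∑ i ∈ Finset.range (L + m), forwardAvg m y (i + 1) * (G (i + 1) - G i) =
      ∑ i ∈ Finset.range (L + m), y (i + 1) * (backwardAvg m G (i + 1) - backwardAvg m G i) := by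
  -- For each offset `j ≤ m` the two sums differ by an index shift. The unmatched terms vanish: the
  -- last `j` on the left lie beyond time `L`, the first `j` on the right before time 0.
  have key : ∀ j ∈ Finset.range (m + 1),
      ∑ i ∈ Finset.range (L + m), y ((i : ℤ) + 1 + j) * (G (i + 1) - G i) =
      ∑ i ∈ Finset.range (L + m), y (i + 1) * (G (i + 1 - j) - G (i - j)) := by
    intro j hj
    obtain ⟨d, rfl⟩ := Nat.exists_eq_add_of_le (Nat.lt_succ_iff.mp (Finset.mem_range.mp hj))
    have e1 : L + (j + d) = (L + d) + j := by ring
    have e2 : L + (j + d) = j + (L + d) := by ring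
    conv_lhs => rw [e1, Finset.sum_range_add]
    conv_rhs => rw [e2, Finset.sum_range_add]
    rw [Finset.sum_eq_zero (s := Finset.range j), Finset.sum_eq_zero (s := Finset.range j), add_zero,
      zero_add]
    · refine Finset.sum_congr rfl fun i _ => ?_
      push_cast
      have e3 : (i : ℤ) + 1 + j = j + i + 1 := by ring
      have e4 : (j : ℤ) + i + 1 - j = i + 1 := by ring
      have e5 : (j : ℤ) + i - j = i := by ring
      rw [e3, e4, e5]
    · intro i hi
      have := Finset.mem_range.mp hi
      rw [h0 _ (by omega), h0 _ (by omega), sub_zero, mul_zero]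
    · intro i _
      rw [hL _ (by push_cast; omega), hL _ (by push_cast; omega), sub_self, mul_zero]
  simp only [forwardAvg, backwardAvg, ← mul_sub, ← Finset.sum_sub_distrib]
  simp only [mul_assoc, mul_left_comm (y _), ← Finset.mul_sum, Finset.sum_mul]
  congr 1
  simp only [Finset.mul_sum]
  rw [Finset.sum_comm, Finset.sum_congr rfl key, Finset.sum_comm]

/-- Summing `hle` against the increments of `g (X ·)` compares two discretized integrals. Only the
one of `φ` costs an error, namely mesh times total increase of `φ`, hence at most `1 / (m + 1)`
whatever `L` is. -/
theorem potential_le_of_le_step (hφ01 : ∀ y ∈ Icc (0 : ℝ) 1, φ y ∈ Icc (0 : ℝ) 1)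
    (hφ : MonotoneOn φ (Icc 0 1)) (hg01 : ∀ y ∈ Icc (0 : ℝ) 1, g y ∈ Icc (0 : ℝ) 1)
    (hg : MonotoneOn g (Icc 0 1)) (hg0 : g 0 = 0) {m L : ℕ} {X : ℤ → ℝ} {ξ : ℝ}
    (hX : Monotone X) (hX01 : ∀ t, X t ∈ Icc (0 : ℝ) 1) (h0 : ∀ t ≤ 0, X t = 0)
    (hL : ∀ t ≥ (L : ℤ), X t = ξ)
    (hle : ∀ t, X t ≤ forwardAvg m (fun s => φ (backwardAvg m (fun r => g (X r)) s)) t) :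
    ξ * g ξ - (∫ z in (0 : ℝ)..ξ, g z) - (∫ z in (0 : ℝ)..(g ξ), φ z) ≤ 1 / ((m : ℝ) + 1) := by
  set z : ℤ → ℝ := backwardAvg m fun r => g (X r) with hz
  have hgX : ∀ s t, s ≤ t → g (X s) ≤ g (X t) := fun s t h => hg (hX01 _) (hX01 _) (hX h)
  have hz01 : ∀ s, z s ∈ Icc (0 : ℝ) 1 := fun s => backwardAvg_mem_Icc fun r => hg01 _ (hX01 r)
  have hzm : ∀ i : ℕ, z i ≤ z (i + 1) := fun i =>  by
    simp only [hz, backwardAvg]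
    gcongr
    exact hgX _ _ (by omega)
  -- Adjacent windows share all but one of their `m + 1` terms, and each term lies in `[0, 1]`.
  have hdz : ∀ i : ℕ, z (i + 1) - z i ≤ 1 / ((m : ℝ) + 1) := fun i => by
    simp only [hz, backwardAvg, ← mul_sub]
    refine mul_le_of_le_one_right (by positivity) ?_
    rw [Finset.sum_range_succ', Finset.sum_range_succ]
    have : ∀ k ∈ Finset.range m, g (X ((i : ℤ) + 1 - (k + 1 : ℕ))) = g (X (i - k)) := fun k _ => by
      congr 2; push_cast; ring
    rw [Finset.sum_congr rfl this]
    have h1 := (hg01 _ (hX01 ((i : ℤ) + 1 - (0 : ℕ)))).2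
    have h2 := (hg01 _ (hX01 ((i : ℤ) - m))).1
    linarith
  have hz0 : z 0 = 0 := by
    simp only [hz]
    rw [backwardAvg_congr (b := fun _ => 0), backwardAvg_const]
    intro j _
    rw [h0 _ (by omega), hg0]
  have hzL : z ((L + m : ℕ) : ℤ) = g ξ := by
    simp only [hz]
    rw [backwardAvg_congr (b := fun _ => g ξ), backwardAvg_const]
    intro j hj
    rw [hL _ (by push_cast; omega)]
  have hsum := sum_forwardAvg_mul_sub (m := m) (L := L) (y := fun s => φ (z s))
    (G := fun r => g (X r)) (c := g ξ) (fun t ht => by rw [h0 t ht, hg0])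
    (fun t ht => by rw [hL t ht])
  -- As `g` is monotone, `x * g x - ∫ g` grows from `x` to `x'` by at most `x' * (g x' - g x)`; then
  -- `hle` bounds `x'`.
  have lower : ξ * g ξ - (∫ z in (0 : ℝ)..ξ, g z) ≤
      ∑ i ∈ Finset.range (L + m), forwardAvg m (fun s => φ (z s)) (i + 1) *
        (g (X (i + 1)) - g (X i)) := by
    have tele := Finset.sum_range_sub
      (fun i : ℕ => X i * g (X i) - ∫ z in (0 : ℝ)..X i, g z) (L + m)
    rw [hL _ (by push_cast; omega), h0 _ (by simp)] at tele
    simp only [intervalIntegral.integral_same, zero_mul, sub_zero] at tele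
    rw [← tele]
    refine Finset.sum_le_sum fun i _ => ?_
    push_cast
    have h1 := hg.mul_sub_le_integral (hX01 i) (hX01 (i + 1)) (hX (by omega))
    have h2 := mul_le_mul_of_nonneg_right (hle (i + 1))
      (sub_nonneg.2 (hgX i (i + 1) (by omega)))
    linarith
  -- The right-endpoint sum exceeds the left-endpoint sum by at most the mesh times `φ (g ξ) - φ 0 ≤
  -- 1`, and the left-endpoint sum is below the integral.
  have upper : ∑ i ∈ Finset.range (L + m), φ (z (i + 1)) * (z (i + 1) - z i) ≤
      (∫ z in (0 : ℝ)..(g ξ), φ z) + 1 / ((m : ℝ) + 1) := by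
    have tele := Finset.sum_range_sub (fun i : ℕ => ∫ x in (0 : ℝ)..z i, φ x) (L + m)
    have tele' := Finset.sum_range_sub (fun i : ℕ => φ (z i)) (L + m)
    rw [hzL] at tele tele'
    simp only [Nat.cast_zero, hz0, intervalIntegral.integral_same, sub_zero] at tele tele'
    have h1 : φ (g ξ) - φ 0 ≤ 1 := by
      have h1 := (hφ01 _ (hzL ▸ hz01 _)).2
      have h2 := (hφ01 0 (by simp)).1
      linarith
    calc _ ≤ ∑ i ∈ Finset.range (L + m),
            (((∫ x in (0 : ℝ)..z (i + 1 : ℕ), φ x) - ∫ x in (0 : ℝ)..z i, φ x)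
              + 1 / ((m : ℝ) + 1) * (φ (z (i + 1 : ℕ)) - φ (z i))) := by
          refine Finset.sum_le_sum fun i _ => ?_
          push_cast
          have h1 := hφ.mul_sub_le_integral (hz01 i) (hz01 (i + 1)) (hzm i)
          have h2 := mul_le_mul_of_nonneg_right (hdz i)
            (sub_nonneg.2 (hφ (hz01 i) (hz01 (i + 1)) (hzm i)))
          linarith
      _ ≤ _ := by
          rw [Finset.sum_add_distrib, tele, ← Finset.mul_sum, tele']
          have := mul_le_mul_of_nonneg_left h1 (by positivity : (0 : ℝ) ≤ 1 / ((m : ℝ) + 1))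
          linarith
  linarith

end Potential

/-! ### Threshold saturation for monotone systems. -/

section Saturation

variable {f : ℝ → ℝ → ℝ} {g : ℝ → ℝ}

/-- `f` enters only through its primitive, which is continuous although `f` is merely monotone. -/
theorem continuousOn_potential {ε : ℝ} (hf : MonotoneOn (fun y => f y ε) (Icc 0 1))
    (hg01 : ∀ y ∈ Icc (0 : ℝ) 1, g y ∈ Icc (0 : ℝ) 1) (hg : ContinuousOn g (Icc 0 1)) :
    ContinuousOn (fun x => potential f g x ε) (Icc 0 1) := by
  have h01 : (0 : ℝ) ≤ 1 := zero_le_one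
  have prim : ∀ h : ℝ → ℝ, IntervalIntegrable h MeasureTheory.volume 0 1 →
      ContinuousOn (fun x => ∫ z in (0 : ℝ)..x, h z) (Icc 0 1) := fun h hh => by
    have := intervalIntegral.continuousOn_primitive_interval' hh (a := 0) (by simp)
    rwa [uIcc_of_le h01] at this
  refine ((continuousOn_id.mul hg).sub (prim g ?_)).sub ((prim (fun z => f z ε) ?_).comp hg hg01)
  · exact ContinuousOn.intervalIntegrable (by rwa [uIcc_of_le h01])
  · exact hf.intervalIntegrable_of_mem (by simp) (by simp)

theorem zero_mem_minUnstable {ε : ℝ} :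
    (0 : ℝ) ∈ {y | y ∈ Icc (0 : ℝ) 1 ∧ ∀ x ∈ Ioo 0 y, f (g x) ε < x} :=
  ⟨by simp, fun _ hx => absurd hx.1 (not_lt.2 hx.2.le)⟩

theorem step_lt_of_lt_minUnstable {ε x : ℝ} (h0 : 0 < x) (hx : x < minUnstable f g ε) :
    f (g x) ε < x := by
  obtain ⟨y, hy, hxy⟩ := exists_lt_of_lt_csSup ⟨0, zero_mem_minUnstable⟩ hx
  exact hy.2 x ⟨h0, hxy⟩

theorem minUnstable_le_one {ε : ℝ} : minUnstable f g ε ≤ 1 :=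
  csSup_le ⟨0, zero_mem_minUnstable⟩ fun _ hy => hy.1.2

/-- The running maximum of a fixed point of the coupled recursion. -/
theorem exists_monotone_majorant {φ φ' : ℝ → ℝ}
    (hφ01 : ∀ y ∈ Icc (0 : ℝ) 1, φ y ∈ Icc (0 : ℝ) 1) (hφ : MonotoneOn φ (Icc 0 1))
    (hφ' : ∀ y ∈ Icc (0 : ℝ) 1, φ' y ≤ φ y)
    (hg01 : ∀ y ∈ Icc (0 : ℝ) 1, g y ∈ Icc (0 : ℝ) 1) (hg : MonotoneOn g (Icc 0 1))
    {m L M : ℕ} {x : ℤ → ℝ} (hx01 : ∀ t, x t ∈ Icc (0 : ℝ) 1)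
    (hx : onChain L (forwardAvg m (onChain M fun s =>
      φ' (backwardAvg m (fun r => g (x r)) s))) = x) :
    ∃ X : ℤ → ℝ, Monotone X ∧ (∀ t, X t ∈ Icc (0 : ℝ) 1) ∧ (∀ t ≤ 0, X t = 0) ∧
      (∀ t ≥ (L : ℤ), X t = X L) ∧ (∀ t, x t ≤ X t) ∧
      ∀ t, X t ≤ forwardAvg m (fun s => φ (backwardAvg m (fun r => g (X r)) s)) t := by
  have hxL : ∀ t, ¬ (1 ≤ t ∧ t ≤ (L : ℤ)) → x t = 0 := fun t ht => by
    rw [← hx, onChain, if_neg ht]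
  let X : ℤ → ℝ := fun t => ⨆ s : {s : ℤ // s ≤ t}, x s
  have hbdd : ∀ t, BddAbove (range fun s : {s : ℤ // s ≤ t} => x s) := fun t =>
    ⟨1, by rintro _ ⟨s, rfl⟩; exact (hx01 s).2⟩
  have : ∀ t : ℤ, Nonempty {s : ℤ // s ≤ t} := fun t => ⟨⟨t, le_rfl⟩⟩
  have hle : ∀ s t, s ≤ t → x s ≤ X t := fun s t h => le_ciSup (hbdd t) ⟨s, h⟩
  have hub : ∀ t c, (∀ s ≤ t, x s ≤ c) → X t ≤ c := fun t c h => ciSup_le fun s => h s s.2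
  have hXm : Monotone X := fun s t h => hub s _ fun r hr => hle r t (hr.trans h)
  have hX01 : ∀ t, X t ∈ Icc (0 : ℝ) 1 := fun t =>
    ⟨(hx01 t).1.trans (hle t t le_rfl), hub t 1 fun s _ => (hx01 s).2⟩
  refine ⟨X, hXm, hX01, fun t ht => ?_, fun t ht => ?_, fun t => hle t t le_rfl, fun t => ?_⟩
  · exact le_antisymm (hub t 0 fun s hs => (hxL s (by omega)).le) (hX01 t).1
  · refine le_antisymm (hub t _ fun s _ => ?_) (hXm ht)
    by_cases hs : s ≤ L
    · exact hle s _ hs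
    · rw [hxL s (by omega)]; exact (hX01 _).1
  · have hz01 : ∀ (y : ℤ → ℝ), (∀ t, y t ∈ Icc (0 : ℝ) 1) → ∀ s,
        backwardAvg m (fun r => g (y r)) s ∈ Icc (0 : ℝ) 1 := fun y hy s =>
      backwardAvg_mem_Icc fun r => hg01 _ (hy r)
    -- For `s ≤ t`, write `x s` as its own update. Dropping the masks, passing from `φ'` to `φ`,
    -- from `x` to `X` and from `s` to `t` can each only increase it, because `φ ≥ 0` and everything
    -- is monotone.
    refine hub t _ fun s hs => ?_
    rw [← hx]
    have hnn : 0 ≤ forwardAvg m (fun s => φ (backwardAvg m (fun r => g (X r)) s)) t :=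
      (forwardAvg_mem_Icc fun r => hφ01 _ (hz01 X hX01 r)).1
    unfold onChain
    split_ifs with h
    · refine le_trans (b := forwardAvg m (fun s => φ (backwardAvg m (fun r => g (X r)) s)) s) ?_ ?_
      · refine forwardAvg_mono fun j _ => ?_
        dsimp only
        split_ifs
        · exact (hφ' _ (hz01 x hx01 _)).trans <| hφ (hz01 x hx01 _) (hz01 X hX01 _) <|
            backwardAvg_mono fun k _ => hg (hx01 _) (hX01 _) (hle _ _ le_rfl)
        · exact (hφ01 _ (hz01 X hX01 _)).1
      · unfold forwardAvg
        gcongr with j _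
        refine hφ (hz01 X hX01 _) (hz01 X hX01 _) ?_
        unfold backwardAvg
        gcongr with k _
        exact hg (hX01 _) (hX01 _) (hXm (by omega))
    · exact hnn

/-- Threshold saturation for monotone systems. -/
theorem thresholdSaturation_of_monotone
    (hf01 : ∀ ε ∈ Icc (0 : ℝ) 1, ∀ y ∈ Icc (0 : ℝ) 1, f y ε ∈ Icc (0 : ℝ) 1)
    (hf : ∀ ε ∈ Icc (0 : ℝ) 1, MonotoneOn (fun y => f y ε) (Icc 0 1))
    (hfε : ∀ y ∈ Icc (0 : ℝ) 1, MonotoneOn (f y) (Icc 0 1))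
    (hg01 : ∀ y ∈ Icc (0 : ℝ) 1, g y ∈ Icc (0 : ℝ) 1)
    (hg : MonotoneOn g (Icc 0 1)) (hgc : ContinuousOn g (Icc 0 1)) (hg0 : g 0 = 0) :
    ThresholdSaturation f g := by
  intro ε hε hlt
  -- For the empty set the supremum is 0, which cannot exceed `ε ≥ 0`.
  have hne : {ε | ε ∈ Icc (0 : ℝ) 1 ∧ 0 < minUnstable f g ε ∧
      ∀ x ∈ Icc (minUnstable f g ε) 1, 0 < potential f g x ε}.Nonempty := by
    by_contra h
    rw [not_nonempty_iff_eq_empty] at h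
    rw [potentialThreshold, h, Real.sSup_empty] at hlt
    exact absurd hε.1 (not_le.2 hlt)
  -- The conditions on the potential are used at this `ε' > ε` only; monotonicity in `ε` bounds the
  -- recursion at `ε` by the one at `ε'`.
  obtain ⟨ε', ⟨hε', hu, hU⟩, hεε'⟩ := exists_lt_of_lt_csSup hne hlt
  have hsub : Icc (minUnstable f g ε') 1 ⊆ Icc (0 : ℝ) 1 := Icc_subset_Icc_left hu.le
  obtain ⟨x₀, hx₀, hmin⟩ := isCompact_Icc.exists_isMinOn (nonempty_Icc.2 minUnstable_le_one)
    ((continuousOn_potential (hf ε' hε') hg01 hgc).mono hsub)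
  -- `m₀` makes the error `1 / (m₀ + 1)` smaller than the minimum of the potential on `[u(ε'), 1]`.
  obtain ⟨m₀, hm₀⟩ := exists_nat_one_div_lt (hU x₀ hx₀)
  have h00 : (0 : ℝ) ∈ Icc (0 : ℝ) 1 := by simp
  -- Needed for 0 to be a fixed point at all: `f 0 ε ≤ f (g y) ε' < y` for all small `y > 0`.
  have hf0 : f 0 ε = 0 := by
    refine le_antisymm (le_of_forall_pos_le_add fun η hη => ?_) (hf01 ε hε 0 h00).1
    obtain ⟨y, hy0, hy⟩ := exists_between (lt_min hη hu)
    have hy01 : y ∈ Icc (0 : ℝ) 1 :=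
      ⟨hy0.le, (hy.le.trans (min_le_right _ _)).trans minUnstable_le_one⟩
    calc f 0 ε ≤ f 0 ε' := hfε 0 h00 hε hε' hεε'.le
      _ ≤ f (g y) ε' := hf ε' hε' h00 (hg01 y hy01) (hg01 y hy01).1
      _ ≤ y := (step_lt_of_lt_minUnstable hy0 (hy.trans_le (min_le_right _ _))).le
      _ ≤ 0 + η := by linarith [min_le_left η (minUnstable f g ε')]
  refine ⟨m₀, fun m hm L M x hx01 => ⟨fun hx => ?_, ?_⟩⟩
  · obtain ⟨X, hXm, hX01, hX0, hXL, hxX, hXle⟩ := exists_monotone_majorant (hf01 ε' hε')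
      (hf ε' hε') (fun y hy => hfε y hy hε hε' hεε'.le) hg01 hg hx01 hx
    have hpot := potential_le_of_le_step (hf01 ε' hε') (hf ε' hε') hg01 hg hg0 hXm hX01 hX0 hXL hXle
    have htop : ∀ t, X t ≤ X L := fun t => by
      rcases le_total t L with h | h
      · exact hXm h
      · exact (hXL t h).le
    -- Replacing every entry by the maximum `X L` turns the averages into constants, so the end
    -- value obeys the uncoupled inequality.
    have hfix : X L ≤ f (g (X L)) ε' := by
      refine (hXle L).trans ((forwardAvg_mono fun j _ => ?_).trans
        (forwardAvg_const (m := m) (t := L) _).le)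
      refine hf ε' hε' (backwardAvg_mem_Icc fun r => hg01 _ (hX01 r)) (hg01 _ (hX01 _)) ?_
      exact (backwardAvg_mono fun k _ => hg (hX01 _) (hX01 _) (htop _)).trans
        (backwardAvg_const _).le
    have hzero : X L ≤ 0 := by
      by_contra! hpos
      have hge : minUnstable f g ε' ≤ X L := by
        by_contra! hlt
        exact absurd hfix (not_le.2 (step_lt_of_lt_minUnstable hpos hlt))
      have h1 : potential f g x₀ ε' ≤ potential f g (X L) ε' := hmin ⟨hge, (hX01 _).2⟩
      have h2 : 1 / ((m : ℝ) + 1) ≤ 1 / ((m₀ : ℝ) + 1) :=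
        one_div_le_one_div_of_le (by positivity) (by gcongr)
      have h3 : potential f g (X L) ε' ≤ 1 / ((m : ℝ) + 1) := hpot
      linarith
    funext t
    exact le_antisymm ((hxX t).trans ((htop t).trans hzero)) (hx01 t).1
  · rintro rfl
    funext t
    have h2 : forwardAvg m (fun _ => (0 : ℝ)) = fun _ => 0 := funext fun _ => forwardAvg_const 0
    simp [coupledStep, hg0, backwardAvg_const, hf0, h2]

end Saturation

/-! ### Monotone Markov chains on a finite ordered set. -/

open Filter Topology

open Classical in
theorem monotone_ite_le {α : Type*} [PartialOrder α] (a : α) : Monotone fun a' => if a ≤ a' then (1 : ℝ) else 0 := by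
  intro x y hxy
  dsimp only
  split_ifs with h1 h2 <;> first | exact absurd (h1.trans hxy) h2 | norm_num

open Classical in
theorem monotone_ite_lt {α : Type*} [PartialOrder α] (a : α) : Monotone fun a' => if a < a' then (1 : ℝ) else 0 := by
  intro x y hxy
  dsimp only
  split_ifs with h1 h2 <;> first | exact absurd (h1.trans_le hxy) h2 | norm_num

section MarkovChain

variable {α ι : Type*} [Fintype α] [DecidableEq α] [Fintype ι]

/-- Transition matrix of the Markov chain on `α` that applies the map `step e` with probability
`μ e`. -/
def stepMatrix (step : ι → α → α) (μ : ι → ℝ) : Matrix α α ℝ :=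
  fun a a' => ∑ e, if step e a = a' then μ e else 0

variable {step : ι → α → α} {μ μ' : ι → ℝ} {φ ψ : α → ℝ}

theorem stepMatrix_mulVec (φ : α → ℝ) (a : α) :
    (stepMatrix step μ).mulVec φ a = ∑ e, μ e * φ (step e a) := by
  simp only [Matrix.mulVec, dotProduct, stepMatrix, Finset.sum_mul]
  rw [Finset.sum_comm]
  refine Finset.sum_congr rfl fun e _ => ?_
  rw [Finset.sum_eq_single (step e a)] <;> simp +contextual [eq_comm]

theorem stepMatrix_pow_succ_mulVec (N : ℕ) (φ : α → ℝ) (a : α) :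
    (stepMatrix step μ ^ (N + 1)).mulVec φ a =
      ∑ e, μ e * (stepMatrix step μ ^ N).mulVec φ (step e a) := by
  rw [pow_succ', ← Matrix.mulVec_mulVec, stepMatrix_mulVec]

theorem stepMatrix_pow_mulVec_const (hμ : ∑ e, μ e = 1) (N : ℕ) (c : ℝ) (a : α) :
    (stepMatrix step μ ^ N).mulVec (fun _ => c) a = c := by
  induction N generalizing a with
  | zero => simp
  | succ N ih => simp only [stepMatrix_pow_succ_mulVec, ih, ← Finset.sum_mul, hμ, one_mul]

theorem stepMatrix_pow_mulVec_mono (hμ : ∀ e, 0 ≤ μ e) (h : ∀ a, φ a ≤ ψ a) (N : ℕ) (a : α) :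
    (stepMatrix step μ ^ N).mulVec φ a ≤ (stepMatrix step μ ^ N).mulVec ψ a := by
  induction N generalizing a with
  | zero => simpa using h a
  | succ N ih =>
    simp only [stepMatrix_pow_succ_mulVec]
    exact Finset.sum_le_sum fun e _ => mul_le_mul_of_nonneg_left (ih _) (hμ e)

theorem stepMatrix_pow_mulVec_mem_Icc (hμ : ∀ e, 0 ≤ μ e) (hμ1 : ∑ e, μ e = 1)
    (h : ∀ a, φ a ∈ Icc (0 : ℝ) 1) (N : ℕ) (a : α) :
    (stepMatrix step μ ^ N).mulVec φ a ∈ Icc (0 : ℝ) 1 := by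
  constructor
  · rw [← stepMatrix_pow_mulVec_const (step := step) hμ1 N 0 a]
    exact stepMatrix_pow_mulVec_mono hμ (fun a => (h a).1) N a
  · rw [← stepMatrix_pow_mulVec_const (step := step) hμ1 N 1 a]
    exact stepMatrix_pow_mulVec_mono hμ (fun a => (h a).2) N a

/-- The chain stays in an invariant set. -/
theorem stepMatrix_pow_mulVec_eq_zero {Inv : α → Prop}
    (hstep : ∀ e a, μ e ≠ 0 → Inv a → Inv (step e a)) (hφ : ∀ a, Inv a → φ a = 0) (N : ℕ) {a : α}
    (ha : Inv a) : (stepMatrix step μ ^ N).mulVec φ a = 0 := by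
  induction N generalizing a with
  | zero => simpa using hφ a ha
  | succ N ih =>
    rw [stepMatrix_pow_succ_mulVec]
    refine Finset.sum_eq_zero fun e _ => ?_
    by_cases he : μ e = 0
    · rw [he, zero_mul]
    · rw [ih (hstep e a he ha), mul_zero]

theorem stepMatrix_pow_apply_eq_zero {Inv : α → Prop}
    (hstep : ∀ e a, μ e ≠ 0 → Inv a → Inv (step e a)) (N : ℕ) {a a' : α}
    (ha : Inv a) (ha' : ¬ Inv a') : (stepMatrix step μ ^ N) a a' = 0 := by
  have := stepMatrix_pow_mulVec_eq_zero (φ := Pi.single a' 1) hstep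
    (fun b hb => Pi.single_eq_of_ne (fun h : b = a' => ha' (h ▸ hb)) _) N ha
  simpa using this

variable [PartialOrder α]

theorem stepMatrix_pow_mulVec_monotone (hstep : ∀ e, Monotone (step e)) (hμ : ∀ e, 0 ≤ μ e)
    (hφ : Monotone φ) (N : ℕ) : Monotone ((stepMatrix step μ ^ N).mulVec φ) := by
  induction N with
  | zero => simpa using hφ
  | succ N ih =>
    intro a b hab
    simp only [stepMatrix_pow_succ_mulVec]
    exact Finset.sum_le_sum fun e _ => mul_le_mul_of_nonneg_left (ih (hstep e hab)) (hμ e)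

/-- The first step moves the start `b` upward and later steps preserve the order, so one more step
can only raise the expectation of a monotone function. -/
theorem monotone_stepMatrix_pow_mulVec (hstep : ∀ e, Monotone (step e)) (hμ : ∀ e, 0 ≤ μ e)
    (hμ1 : ∑ e, μ e = 1) (hφ : Monotone φ) {b : α} (hb : ∀ e, b ≤ step e b) :
    Monotone fun N => (stepMatrix step μ ^ N).mulVec φ b := by
  refine monotone_nat_of_le_succ fun N => ?_
  rw [stepMatrix_pow_succ_mulVec, ← one_mul ((stepMatrix step μ ^ N).mulVec φ b), ← hμ1,
    Finset.sum_mul]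
  exact Finset.sum_le_sum fun e _ => mul_le_mul_of_nonneg_left
    (stepMatrix_pow_mulVec_monotone hstep hμ hφ N (hb e)) (hμ e)

theorem antitone_stepMatrix_pow_mulVec (hstep : ∀ e, Monotone (step e)) (hμ : ∀ e, 0 ≤ μ e)
    (hμ1 : ∑ e, μ e = 1) (hφ : Monotone φ) {t : α} (ht : ∀ a, a ≤ t) :
    Antitone fun N => (stepMatrix step μ ^ N).mulVec φ t := by
  refine antitone_nat_of_succ_le fun N => ?_
  rw [stepMatrix_pow_succ_mulVec, ← one_mul ((stepMatrix step μ ^ N).mulVec φ t), ← hμ1,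
    Finset.sum_mul]
  exact Finset.sum_le_sum fun e _ => mul_le_mul_of_nonneg_left
    (stepMatrix_pow_mulVec_monotone hstep hμ hφ N (ht _)) (hμ e)

/-- `hlaw` is stochastic domination of `μ` by `μ'`. The law is exchanged step by step, each time
against a function that is monotone in the step label. -/
theorem stepMatrix_pow_mulVec_le_of_law_le [Preorder ι] (hstep : ∀ e, Monotone (step e))
    (hstep' : ∀ a, Monotone fun e => step e a) (hμ : ∀ e, 0 ≤ μ e)
    (hlaw : ∀ h : ι → ℝ, Monotone h → ∑ e, μ e * h e ≤ ∑ e, μ' e * h e)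
    (hμ' : ∀ e, 0 ≤ μ' e) (hφ : Monotone φ) (N : ℕ) (a : α) :
    (stepMatrix step μ ^ N).mulVec φ a ≤ (stepMatrix step μ' ^ N).mulVec φ a := by
  induction N generalizing a with
  | zero => simp
  | succ N ih =>
    simp only [stepMatrix_pow_succ_mulVec]
    calc _ ≤ ∑ e, μ e * (stepMatrix step μ' ^ N).mulVec φ (step e a) :=
          Finset.sum_le_sum fun e _ => mul_le_mul_of_nonneg_left (ih _) (hμ e)
      _ ≤ _ := hlaw _ fun e e' h =>
          stepMatrix_pow_mulVec_monotone hstep hμ' hφ N (hstep' a h)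

theorem exists_tendsto_stepMatrix_pow_mulVec (hstep : ∀ e, Monotone (step e))
    (hμ : ∀ e, 0 ≤ μ e) (hμ1 : ∑ e, μ e = 1) (hφ : Monotone φ) {b t : α}
    (hb : ∀ e, b ≤ step e b) (ht : ∀ a, a ≤ t) :
    ∃ c, Tendsto (fun N => (stepMatrix step μ ^ N).mulVec φ b) atTop (𝓝 c) := by
  refine ⟨_, tendsto_atTop_ciSup (monotone_stepMatrix_pow_mulVec hstep hμ hμ1 hφ hb) ⟨φ t, ?_⟩⟩
  rintro _ ⟨N, rfl⟩
  exact (stepMatrix_pow_mulVec_monotone hstep hμ hφ N (ht b)).trans <| by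
    simpa using antitone_stepMatrix_pow_mulVec hstep hμ hμ1 hφ ht (Nat.zero_le N)

/-- Doeblin's bound: `n` steps `e₀` in a row couple the chain with its smallest state. -/
theorem stepMatrix_pow_mulVec_le_doeblin (hstep : ∀ e, Monotone (step e))
    (hμ : ∀ e, 0 ≤ μ e) (hμ1 : ∑ e, μ e = 1) (hφ : Monotone φ) {t : α} (ht : ∀ a, a ≤ t) (e₀ : ι)
    (n : ℕ) (a : α) :
    (stepMatrix step μ ^ n).mulVec φ a ≤
      μ e₀ ^ n * φ ((step e₀)^[n] a) + (1 - μ e₀ ^ n) * φ t := by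
  classical
  induction n generalizing a with
  | zero => simp
  | succ n ih =>
    -- The first step is either `e₀`, handled by induction, or another one, where the crude bound `φ
    -- t` is used.
    rw [stepMatrix_pow_succ_mulVec, ← Finset.add_sum_erase _ _ (Finset.mem_univ e₀)]
    have h1 : ∑ e ∈ Finset.univ.erase e₀, μ e = 1 - μ e₀ := by
      rw [← hμ1, ← Finset.add_sum_erase _ _ (Finset.mem_univ e₀)]; ring
    have h2 : ∑ e ∈ Finset.univ.erase e₀, μ e * (stepMatrix step μ ^ n).mulVec φ (step e a) ≤
        (1 - μ e₀) * φ t := by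
      rw [← h1, Finset.sum_mul]
      refine Finset.sum_le_sum fun e _ => mul_le_mul_of_nonneg_left ?_ (hμ e)
      exact (stepMatrix_pow_mulVec_monotone hstep hμ hφ n (ht _)).trans <| by
        simpa using antitone_stepMatrix_pow_mulVec hstep hμ hμ1 hφ ht (Nat.zero_le n)
    have h3 := mul_le_mul_of_nonneg_left (ih (step e₀ a)) (hμ e₀)
    rw [Function.iterate_succ_apply, pow_succ]
    linarith

/-- The limits `c` from below and `d` from above exist by monotonicity. As `n` steps `e₀` bring even
`t` below `b`, Doeblin's bound gives `d ≤ p * c + (1 - p) * d` with `p = μ e₀ ^ n > 0`, hence `d ≤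
c`. -/
theorem tendsto_stepMatrix_pow_mulVec_top (hstep : ∀ e, Monotone (step e))
    (hμ : ∀ e, 0 ≤ μ e) (hμ1 : ∑ e, μ e = 1) (hφ : Monotone φ) {b t : α}
    (hb : ∀ e, b ≤ step e b) (ht : ∀ a, a ≤ t) {e₀ : ι} {n : ℕ} (he : (step e₀)^[n] t ≤ b)
    (he₀ : 0 < μ e₀) {c : ℝ}
    (hc : Tendsto (fun N => (stepMatrix step μ ^ N).mulVec φ b) atTop (𝓝 c)) :
    Tendsto (fun N => (stepMatrix step μ ^ N).mulVec φ t) atTop (𝓝 c) := by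
  have hle : ∀ N, (stepMatrix step μ ^ N).mulVec φ b ≤ (stepMatrix step μ ^ N).mulVec φ t :=
    fun N => stepMatrix_pow_mulVec_monotone hstep hμ hφ N (ht b)
  have hanti := antitone_stepMatrix_pow_mulVec hstep hμ hμ1 hφ ht
  obtain ⟨d, hd⟩ : ∃ d, Tendsto (fun N => (stepMatrix step μ ^ N).mulVec φ t) atTop (𝓝 d) := by
    refine ⟨_, tendsto_atTop_ciInf hanti ⟨φ b, ?_⟩⟩
    rintro _ ⟨N, rfl⟩
    refine le_trans ?_ (hle N)
    simpa using monotone_stepMatrix_pow_mulVec hstep hμ hμ1 hφ hb (Nat.zero_le N)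
  have hcd : c ≤ d := le_of_tendsto_of_tendsto' hc hd hle
  have hdc : d ≤ μ e₀ ^ n * c + (1 - μ e₀ ^ n) * d := by
    refine le_of_tendsto_of_tendsto' (hd.comp (tendsto_add_atTop_nat n))
      ((hc.const_mul _).add (hd.const_mul _)) fun N => ?_
    have hm := stepMatrix_pow_mulVec_monotone hstep hμ hφ N
    have := stepMatrix_pow_mulVec_le_doeblin hstep hμ hμ1 hm ht e₀ n t
    rw [Matrix.mulVec_mulVec, ← pow_add, add_comm n N] at this
    exact this.trans (add_le_add_left
      (mul_le_mul_of_nonneg_left (hm he) (pow_nonneg (hμ e₀) n)) _)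
  have : d = c := le_antisymm (by nlinarith [pow_pos he₀ n]) hcd
  rwa [this] at hd

-- A point mass is not monotone, but it is the difference of two indicators of up-sets. Convergence
-- of matrix entries thus follows from convergence for monotone functions.
open Classical in
theorem stepMatrix_pow_apply_eq_sub (N : ℕ) (a b : α) :
    (stepMatrix step μ ^ N) b a =
      (stepMatrix step μ ^ N).mulVec (fun a' => if a ≤ a' then 1 else 0) b -
      (stepMatrix step μ ^ N).mulVec (fun a' => if a < a' then 1 else 0) b := by
  rw [← Pi.sub_apply, ← Matrix.mulVec_sub]
  have : ((fun a' => if a ≤ a' then 1 else 0) - fun a' => if a < a' then 1 else 0 : α → ℝ) =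
      Pi.single a 1 := by
    funext a'
    rcases eq_or_ne a' a with rfl | h
    · simp
    · have : a ≤ a' ↔ a < a' := ⟨fun h' => lt_of_le_of_ne h' h.symm, le_of_lt⟩
      simp [this, h]
  rw [this]
  simp

theorem exists_tendsto_stepMatrix_pow_apply (hstep : ∀ e, Monotone (step e))
    (hμ : ∀ e, 0 ≤ μ e) (hμ1 : ∑ e, μ e = 1) {b t : α}
    (hb : ∀ e, b ≤ step e b) (ht : ∀ a, a ≤ t) (a : α) :
    ∃ c, Tendsto (fun N => (stepMatrix step μ ^ N) b a) atTop (𝓝 c) := by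
  classical
  obtain ⟨c, hc⟩ := exists_tendsto_stepMatrix_pow_mulVec hstep hμ hμ1 (monotone_ite_le a) hb ht
  obtain ⟨d, hd⟩ := exists_tendsto_stepMatrix_pow_mulVec hstep hμ hμ1 (monotone_ite_lt a) hb ht
  refine ⟨c - d, ?_⟩
  simp only [stepMatrix_pow_apply_eq_sub]
  exact hc.sub hd

theorem tendsto_stepMatrix_pow_apply_top (hstep : ∀ e, Monotone (step e))
    (hμ : ∀ e, 0 ≤ μ e) (hμ1 : ∑ e, μ e = 1) {b t : α}
    (hb : ∀ e, b ≤ step e b) (ht : ∀ a, a ≤ t) {e₀ : ι} {n : ℕ} (he : (step e₀)^[n] t ≤ b)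
    (he₀ : 0 < μ e₀) {a : α} {c : ℝ}
    (hc : Tendsto (fun N => (stepMatrix step μ ^ N) b a) atTop (𝓝 c)) :
    Tendsto (fun N => (stepMatrix step μ ^ N) t a) atTop (𝓝 c) := by
  classical
  obtain ⟨x, hx⟩ := exists_tendsto_stepMatrix_pow_mulVec hstep hμ hμ1 (monotone_ite_le a) hb ht
  obtain ⟨y, hy⟩ := exists_tendsto_stepMatrix_pow_mulVec hstep hμ hμ1 (monotone_ite_lt a) hb ht
  have hx' := tendsto_stepMatrix_pow_mulVec_top hstep hμ hμ1 (monotone_ite_le a) hb ht he he₀ hx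
  have hy' := tendsto_stepMatrix_pow_mulVec_top hstep hμ hμ1 (monotone_ite_lt a) hb ht he he₀ hy
  simp only [stepMatrix_pow_apply_eq_sub] at hc ⊢
  rw [tendsto_nhds_unique hc (hx.sub hy)]
  exact hx'.sub hy'

end MarkovChain

/-! ### Product laws of erasure sets. -/

section SectionLaw

variable {ι : Type*} [DecidableEq ι] {p p' : ι → ℝ}

theorem sum_powerset_insert_prod {a : ι} {s : Finset ι} (ha : a ∉ s) (p : ι → ℝ)
    (h : Finset ι → ℝ) :
    ∑ E ∈ (insert a s).powerset, (∏ l ∈ insert a s, if l ∈ E then p l else 1 - p l) * h E =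
      (1 - p a) * ∑ E ∈ s.powerset, (∏ l ∈ s, if l ∈ E then p l else 1 - p l) * h E +
      p a * ∑ E ∈ s.powerset, (∏ l ∈ s, if l ∈ E then p l else 1 - p l) * h (insert a E) := by
  rw [Finset.sum_powerset_insert ha, Finset.mul_sum, Finset.mul_sum]
  congr 1 <;> refine Finset.sum_congr rfl fun E hE => ?_
  · have : a ∉ E := fun h => ha (Finset.mem_powerset.1 hE h)
    rw [Finset.prod_insert ha, if_neg this, mul_assoc]
  · rw [Finset.prod_insert ha, if_pos (Finset.mem_insert_self _ _), mul_assoc]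
    congr 2
    refine Finset.prod_congr rfl fun l hl => ?_
    have : l ≠ a := fun h => ha (h ▸ hl)
    simp [this]

theorem sum_powerset_prod_eq_one (s : Finset ι) (p : ι → ℝ) :
    ∑ E ∈ s.powerset, (∏ l ∈ s, if l ∈ E then p l else 1 - p l) = 1 := by
  induction s using Finset.induction_on with
  | empty => simp
  | insert a s ha ih =>
    have := sum_powerset_insert_prod ha p fun _ => 1
    simp only [mul_one, ih] at this
    rw [this]; ring

/-- Induction over the coordinates: raising `p a` shifts weight from `h E` to the larger `h (insert
a E)`. -/
theorem sum_powerset_prod_mono (hp : ∀ l, p l ∈ Icc (0 : ℝ) 1) (hp' : ∀ l, p' l ∈ Icc (0 : ℝ) 1)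
    (hle : ∀ l, p l ≤ p' l) (s : Finset ι) {h : Finset ι → ℝ} (hh : Monotone h) :
    ∑ E ∈ s.powerset, (∏ l ∈ s, if l ∈ E then p l else 1 - p l) * h E ≤
      ∑ E ∈ s.powerset, (∏ l ∈ s, if l ∈ E then p' l else 1 - p' l) * h E := by
  induction s using Finset.induction_on generalizing h with
  | empty => simp
  | insert a s ha ih =>
    rw [sum_powerset_insert_prod ha, sum_powerset_insert_prod ha]
    have h1 := ih hh
    have h2 := ih (h := fun E => h (insert a E)) fun E E' hE => hh (Finset.insert_subset_insert a hE)
    have h3 : ∑ E ∈ s.powerset, (∏ l ∈ s, if l ∈ E then p' l else 1 - p' l) * h E ≤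
        ∑ E ∈ s.powerset, (∏ l ∈ s, if l ∈ E then p' l else 1 - p' l) * h (insert a E) := by
      refine Finset.sum_le_sum fun E _ =>
        mul_le_mul_of_nonneg_left (hh (Finset.subset_insert a E)) (Finset.prod_nonneg fun l _ => ?_)
      split_ifs
      · exact (hp' l).1
      · exact sub_nonneg.2 (hp' l).2
    have h4 := mul_le_mul_of_nonneg_left h1 (sub_nonneg.2 (hp a).2)
    have h5 := mul_le_mul_of_nonneg_left h2 (hp a).1
    have h6 := mul_le_mul_of_nonneg_left h3 (sub_nonneg.2 (hle a))
    linarith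

end SectionLaw

namespace SystematicEncoder

section Law

variable {k : ℕ} {p p' : Fin (k + 1) → ℝ}

theorem sectionLaw_nonneg (hp : ∀ l, p l ∈ Icc (0 : ℝ) 1) (E : Finset (Fin (k + 1))) :
    0 ≤ sectionLaw p E := by
  refine Finset.prod_nonneg fun l _ => ?_
  split_ifs
  · exact (hp l).1
  · exact sub_nonneg.2 (hp l).2

theorem sum_sectionLaw (p : Fin (k + 1) → ℝ) : ∑ E, sectionLaw p E = 1 := by
  rw [← sum_powerset_prod_eq_one Finset.univ p, Finset.powerset_univ]
  rfl

theorem sum_sectionLaw_mul_mono (hp : ∀ l, p l ∈ Icc (0 : ℝ) 1)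
    (hp' : ∀ l, p' l ∈ Icc (0 : ℝ) 1) (hle : ∀ l, p l ≤ p' l) (h : Finset (Fin (k + 1)) → ℝ)
    (hh : Monotone h) : ∑ E, sectionLaw p E * h E ≤ ∑ E, sectionLaw p' E * h E := by
  have := sum_powerset_prod_mono hp hp' hle Finset.univ hh
  rwa [Finset.powerset_univ] at this

theorem sectionLaw_eq_zero {E : Finset (Fin (k + 1))} {l : Fin (k + 1)} (hl : p l = 0)
    (hE : l ∈ E) : sectionLaw p E = 0 :=
  Finset.prod_eq_zero (Finset.mem_univ l) (by rw [if_pos hE, hl])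

theorem sectionLaw_empty_pos (hp : ∀ l, p l < 1) : 0 < sectionLaw p ∅ :=
  Finset.prod_pos fun l _ => by simpa using hp l

end Law

/-! ### Order properties of the trellis. -/

section Trellis

variable {k : ℕ} (C : SystematicEncoder k)

theorem compatible_mono {E E' : Finset (Fin (k + 1))} (h : E ⊆ E') {s : C.State}
    {u : Fin k → ZMod 2} (hc : C.Compatible E s u) : C.Compatible E' s u :=
  fun l hl => hc l fun hE => hl (h hE)

theorem parity_eq_zero_of_compatible {E : Finset (Fin (k + 1))} {s : C.State}
    {u : Fin k → ZMod 2} (hc : C.Compatible E s u) (hE : Fin.last k ∉ E) : C.parity s u = 0 := by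
  have := hc _ hE
  rwa [label, Fin.snoc_last] at this

theorem input_eq_zero_of_compatible {E : Finset (Fin (k + 1))} {s : C.State}
    {u : Fin k → ZMod 2} (hc : C.Compatible E s u) {j : Fin k} (hE : j.castSucc ∉ E) : u j = 0 := by
  have := hc _ hE
  rwa [label, Fin.snoc_castSucc] at this

theorem register_zero (i : ℕ) : C.register 0 i = 0 := by
  simp [register]

@[simp]
theorem parity_zero : C.parity 0 0 = 0 := by
  simp [parity, register_zero]

@[simp]
theorem nextState_zero : C.nextState 0 0 = 0 := by
  funext i
  simp [nextState, register_zero]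

theorem compatible_zero (E : Finset (Fin (k + 1))) : C.Compatible E 0 0 := by
  intro l _
  refine Fin.lastCases ?_ (fun j => ?_) l
  · rw [label, Fin.snoc_last, parity_zero]
  · rw [label, Fin.snoc_castSucc, Pi.zero_apply]

theorem eq_zero_of_register {s : C.State} (h : ∀ i, C.register s i = 0) : s = 0 := by
  funext i
  simpa [register] using h i

/-- Beyond the memory every term vanishes, since the memory bounds all the degrees; so the recursion
holds for every index without a range condition. -/
theorem register_nextState (s : C.State) (u : Fin k → ZMod 2) (i : ℕ) :
    C.register (C.nextState s u) i = C.register s (i + 1)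
      + ∑ j, (C.feedforward j).coeff (i + 1) * u j
      + C.feedback.coeff (i + 1) * C.parity s u := by
  by_cases hi : i < C.memory
  · simp [register, nextState, hi]
  · have h1 : C.feedback.coeff (i + 1) = 0 :=
      Polynomial.coeff_eq_zero_of_natDegree_lt
        (((le_max_left _ _).trans (not_lt.1 hi)).trans_lt (Nat.lt_succ_self i))
    have h2 : ∀ j, (C.feedforward j).coeff (i + 1) = 0 := fun j =>
      Polynomial.coeff_eq_zero_of_natDegree_lt
        ((((Finset.le_sup (f := fun j => (C.feedforward j).natDegree)
          (Finset.mem_univ j)).trans (le_max_right _ _)).trans (not_lt.1 hi)).trans_lt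
          (Nat.lt_succ_self i))
    have h3 : ¬ i + 1 < C.memory := fun h => hi ((Nat.lt_succ_self i).trans h)
    simp [register, hi, h1, h2, h3]

theorem forwardStep_mono {E E' : Finset (Fin (k + 1))} (hE : E ⊆ E') {A A' : Set C.State}
    (hA : A ⊆ A') : C.forwardStep E A ⊆ C.forwardStep E' A' := by
  rintro _ ⟨s, hs, u, hu, rfl⟩
  exact ⟨s, hA hs, u, C.compatible_mono hE hu, rfl⟩

theorem backwardStep_mono {E E' : Finset (Fin (k + 1))} (hE : E ⊆ E') {A A' : Set C.State}
    (hA : A ⊆ A') : C.backwardStep E A ⊆ C.backwardStep E' A' := by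
  rintro s ⟨u, hu, hs⟩
  exact ⟨u, C.compatible_mono hE hu, hA hs⟩

theorem zero_subset_forwardStep (E : Finset (Fin (k + 1))) : {0} ⊆ C.forwardStep E {0} := by
  rintro _ rfl
  exact ⟨0, rfl, 0, C.compatible_zero E, C.nextState_zero⟩

theorem zero_subset_backwardStep (E : Finset (Fin (k + 1))) : {0} ⊆ C.backwardStep E {0} := by
  rintro _ rfl
  exact ⟨0, C.compatible_zero E, C.nextState_zero⟩

theorem extrinsicErased_mono {l : Fin (k + 1)} {E E' : Finset (Fin (k + 1))}
    {A A' B B' : Set C.State} (hE : E ⊆ E') (hA : A ⊆ A') (hB : B ⊆ B')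
    (h : C.ExtrinsicErased l E A B) : C.ExtrinsicErased l E' A' B' := by
  obtain ⟨s, hs, u, hu, hl, hn⟩ := h
  exact ⟨s, hA hs, u, C.compatible_mono (Finset.insert_subset_insert l hE) hu, hl, hB hn⟩

/-- Without erasures the trellis branches in use shift the zero state in. -/
theorem register_nextState_of_compatible_empty {s : C.State} {u : Fin k → ZMod 2}
    (hc : C.Compatible ∅ s u) (i : ℕ) :
    C.register (C.nextState s u) i = C.register s (i + 1) ∧ C.register s 0 = 0 := by
  have hu : ∀ j, u j = 0 := fun j => C.input_eq_zero_of_compatible hc (by simp)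
  have hp := C.parity_eq_zero_of_compatible hc (by simp)
  refine ⟨by simp [register_nextState, hu, hp], ?_⟩
  simpa [parity, hu] using hp

/-- Each erasure-free step shifts the registers by one and brings in a zero, so after `memory` steps
all registers are zero. This is the event that feeds the Doeblin bound. -/
theorem iterate_forwardStep_empty : (C.forwardStep ∅)^[C.memory] univ ⊆ {0} := by
  have key : ∀ n, ∀ s ∈ (C.forwardStep ∅)^[n] univ, ∀ i, C.memory ≤ i + n →
      C.register s i = 0 := by
    intro n
    induction n with
    | zero => exact fun s _ i hi => dif_neg (not_lt.2 hi)
    | succ n ih =>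
      intro s hs i hi
      rw [Function.iterate_succ_apply'] at hs
      obtain ⟨s', hs', u, hu, rfl⟩ := hs
      rw [(C.register_nextState_of_compatible_empty hu i).1]
      exact ih s' hs' _ (by omega)
  exact fun s hs => C.eq_zero_of_register fun i => key _ s hs i (Nat.le_add_left _ _)

/-- In an erasure-free section the known parity bit reveals register 0 to be zero, and the shift
brings the following registers there one after another. -/
theorem iterate_backwardStep_empty : (C.backwardStep ∅)^[C.memory] univ ⊆ {0} := by
  have key : ∀ n, ∀ s ∈ (C.backwardStep ∅)^[n] univ, ∀ i < n, C.register s i = 0 := by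
    intro n
    induction n with
    | zero => simp
    | succ n ih =>
      intro s hs i hi
      rw [Function.iterate_succ_apply'] at hs
      obtain ⟨u, hu, hs⟩ := hs
      have h := C.register_nextState_of_compatible_empty hu
      cases i with
      | zero => exact (h 0).2
      | succ i => rw [← (h i).1]; exact ih _ hs i (by omega)
  refine fun s hs => C.eq_zero_of_register fun i => ?_
  by_cases hi : i < C.memory
  · exact key _ s hs i hi
  · simp [register, hi]

end Trellis

/-! ### Monotonicity and continuity of the transfer functions. -/

noncomputable section

variable {k : ℕ} (C : SystematicEncoder k)

open Classical in
theorem forwardMatrix_eq (μ : Finset (Fin (k + 1)) → ℝ) :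
    C.forwardMatrix μ = stepMatrix C.forwardStep μ := by
  funext A A'
  simp only [forwardMatrix, stepMatrix]

open Classical in
theorem backwardMatrix_eq (μ : Finset (Fin (k + 1)) → ℝ) :
    C.backwardMatrix μ = stepMatrix C.backwardStep μ := by
  funext A A'
  simp only [backwardMatrix, stepMatrix]

open Classical in
/-- The extrinsic erasure probability of the `l`-th code bit in the middle of a trellis with
`2 N + 1` sections, whose end metrics are `A₀` and `B₀`. -/
def truncatedTransfer (l : Fin (k + 1)) (N : ℕ) (A₀ B₀ : Set C.State) (p : Fin (k + 1) → ℝ) : ℝ :=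
  ∑ A, ∑ B, (C.forwardMatrix (sectionLaw p) ^ N) A₀ A * C.erasureMatrix (sectionLaw p) l A B
    * (C.backwardMatrix (sectionLaw p) ^ N) B₀ B

open Classical in
/-- Indicator of an erased extrinsic output. -/
def erasedIndicator (l : Fin (k + 1)) (A B : Set C.State) (E : Finset (Fin (k + 1))) : ℝ :=
  if C.ExtrinsicErased l E A B then 1 else 0

theorem erasedIndicator_mono {l : Fin (k + 1)} {E E' : Finset (Fin (k + 1))}
    {A A' B B' : Set C.State} (hE : E ⊆ E') (hA : A ⊆ A') (hB : B ⊆ B') :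
    C.erasedIndicator l A B E ≤ C.erasedIndicator l A' B' E' := by
  unfold erasedIndicator
  split_ifs with h h'
  · exact le_rfl
  · exact absurd (C.extrinsicErased_mono hE hA hB h) h'
  · exact zero_le_one
  · exact le_rfl

theorem erasureMatrix_eq (μ : Finset (Fin (k + 1)) → ℝ) (l : Fin (k + 1)) (A B : Set C.State) :
    C.erasureMatrix μ l A B = ∑ E, μ E * C.erasedIndicator l A B E := by
  simp [erasureMatrix, erasedIndicator]

-- As a nested expectation over the two chains, this is accessible to the lemmas on monotone
-- functions, one chain at a time.
open Classical in
theorem truncatedTransfer_eq (l : Fin (k + 1)) (N : ℕ) (A₀ B₀ : Set C.State)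
    (p : Fin (k + 1) → ℝ) :
    C.truncatedTransfer l N A₀ B₀ p =
      (stepMatrix C.forwardStep (sectionLaw p) ^ N).mulVec (fun A =>
        (stepMatrix C.backwardStep (sectionLaw p) ^ N).mulVec
          (fun B => C.erasureMatrix (sectionLaw p) l A B) B₀) A₀ := by
  simp only [truncatedTransfer, Matrix.mulVec, dotProduct, Finset.mul_sum, forwardMatrix_eq,
    backwardMatrix_eq]
  refine Finset.sum_congr rfl fun A _ => Finset.sum_congr rfl fun B _ => ?_
  ring

variable {C} {l : Fin (k + 1)} {p p' : Fin (k + 1) → ℝ}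

theorem erasureMatrix_mono (hp : ∀ l, p l ∈ Icc (0 : ℝ) 1) {A A' B B' : Set C.State}
    (hA : A ⊆ A') (hB : B ⊆ B') :
    C.erasureMatrix (sectionLaw p) l A B ≤ C.erasureMatrix (sectionLaw p) l A' B' := by
  rw [erasureMatrix_eq, erasureMatrix_eq]
  exact Finset.sum_le_sum fun E _ => mul_le_mul_of_nonneg_left
    (C.erasedIndicator_mono subset_rfl hA hB) (sectionLaw_nonneg hp E)

theorem erasureMatrix_law_mono (hp : ∀ l, p l ∈ Icc (0 : ℝ) 1) (hp' : ∀ l, p' l ∈ Icc (0 : ℝ) 1)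
    (hle : ∀ l, p l ≤ p' l) (A B : Set C.State) :
    C.erasureMatrix (sectionLaw p) l A B ≤ C.erasureMatrix (sectionLaw p') l A B := by
  rw [erasureMatrix_eq, erasureMatrix_eq]
  exact sum_sectionLaw_mul_mono hp hp' hle _ fun E E' h =>
    C.erasedIndicator_mono h subset_rfl subset_rfl

theorem erasureMatrix_mem_Icc (hp : ∀ l, p l ∈ Icc (0 : ℝ) 1) (A B : Set C.State) :
    C.erasureMatrix (sectionLaw p) l A B ∈ Icc (0 : ℝ) 1 := by
  have h : ∀ E, C.erasedIndicator l A B E ∈ Icc (0 : ℝ) 1 := fun E => by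
    unfold erasedIndicator
    split_ifs <;> simp
  rw [erasureMatrix_eq]
  constructor
  · exact Finset.sum_nonneg fun E _ => mul_nonneg (sectionLaw_nonneg hp E) (h E).1
  · rw [← sum_sectionLaw p]
    exact Finset.sum_le_sum fun E _ => mul_le_of_le_one_right (sectionLaw_nonneg hp E) (h E).2

section

open Classical

theorem backwardValue_mono (hp : ∀ l, p l ∈ Icc (0 : ℝ) 1) (N : ℕ) (B₀ : Set C.State) :
    Monotone fun A => (stepMatrix C.backwardStep (sectionLaw p) ^ N).mulVec
      (fun B => C.erasureMatrix (sectionLaw p) l A B) B₀ := fun _ _ hA =>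
  stepMatrix_pow_mulVec_mono (sectionLaw_nonneg hp)
    (fun _ => erasureMatrix_mono hp hA subset_rfl) N B₀

theorem erasureMatrix_monotone (hp : ∀ l, p l ∈ Icc (0 : ℝ) 1) (A : Set C.State) :
    Monotone fun B => C.erasureMatrix (sectionLaw p) l A B :=
  fun _ _ hB => erasureMatrix_mono hp subset_rfl hB

theorem forwardStep_monotone (E : Finset (Fin (k + 1))) : Monotone (C.forwardStep E) :=
  fun _ _ h => C.forwardStep_mono subset_rfl h

theorem backwardStep_monotone (E : Finset (Fin (k + 1))) : Monotone (C.backwardStep E) :=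
  fun _ _ h => C.backwardStep_mono subset_rfl h

theorem truncatedTransfer_mem_Icc (hp : ∀ l, p l ∈ Icc (0 : ℝ) 1) (N : ℕ) (A₀ B₀ : Set C.State) :
    C.truncatedTransfer l N A₀ B₀ p ∈ Icc (0 : ℝ) 1 := by
  rw [truncatedTransfer_eq]
  exact stepMatrix_pow_mulVec_mem_Icc (sectionLaw_nonneg hp) (sum_sectionLaw p) (fun A =>
    stepMatrix_pow_mulVec_mem_Icc (sectionLaw_nonneg hp) (sum_sectionLaw p)
      (fun B => erasureMatrix_mem_Icc hp A B) N B₀) N A₀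

/-- The law is replaced successively in the forward chain, in the backward chain and in the middle
section. -/
theorem truncatedTransfer_law_mono (hp : ∀ l, p l ∈ Icc (0 : ℝ) 1)
    (hp' : ∀ l, p' l ∈ Icc (0 : ℝ) 1) (hle : ∀ l, p l ≤ p' l) (N : ℕ) (A₀ B₀ : Set C.State) :
    C.truncatedTransfer l N A₀ B₀ p ≤ C.truncatedTransfer l N A₀ B₀ p' := by
  rw [truncatedTransfer_eq, truncatedTransfer_eq]
  refine (stepMatrix_pow_mulVec_le_of_law_le forwardStep_monotone
    (fun A E E' h => C.forwardStep_mono h subset_rfl) (sectionLaw_nonneg hp)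
    (sum_sectionLaw_mul_mono hp hp' hle) (sectionLaw_nonneg hp')
    (backwardValue_mono hp N B₀) N A₀).trans ?_
  refine stepMatrix_pow_mulVec_mono (sectionLaw_nonneg hp') (fun A => ?_) N A₀
  refine (stepMatrix_pow_mulVec_le_of_law_le backwardStep_monotone
    (fun A E E' h => C.backwardStep_mono h subset_rfl) (sectionLaw_nonneg hp)
    (sum_sectionLaw_mul_mono hp hp' hle) (sectionLaw_nonneg hp')
    (erasureMatrix_monotone hp A) N B₀).trans ?_
  exact stepMatrix_pow_mulVec_mono (sectionLaw_nonneg hp')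
    (fun B => erasureMatrix_law_mono hp hp' hle A B) N B₀

theorem truncatedTransfer_zero_le_univ (hp : ∀ l, p l ∈ Icc (0 : ℝ) 1) (N : ℕ) :
    C.truncatedTransfer l N {0} {0} p ≤ C.truncatedTransfer l N univ univ p := by
  rw [truncatedTransfer_eq, truncatedTransfer_eq]
  refine (stepMatrix_pow_mulVec_monotone forwardStep_monotone (sectionLaw_nonneg hp)
    (backwardValue_mono hp N {0}) N (subset_univ _)).trans ?_
  exact stepMatrix_pow_mulVec_mono (sectionLaw_nonneg hp) (fun A =>
    stepMatrix_pow_mulVec_monotone backwardStep_monotone (sectionLaw_nonneg hp)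
      (erasureMatrix_monotone hp A) N (subset_univ _)) N univ

theorem truncatedTransfer_zero_monotone (hp : ∀ l, p l ∈ Icc (0 : ℝ) 1) :
    Monotone fun N => C.truncatedTransfer l N {0} {0} p := by
  intro N M h
  simp only [truncatedTransfer_eq]
  refine (monotone_stepMatrix_pow_mulVec forwardStep_monotone (sectionLaw_nonneg hp)
    (sum_sectionLaw p) (backwardValue_mono hp N {0}) C.zero_subset_forwardStep h).trans ?_
  exact stepMatrix_pow_mulVec_mono (sectionLaw_nonneg hp) (fun A =>
    monotone_stepMatrix_pow_mulVec backwardStep_monotone (sectionLaw_nonneg hp)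
      (sum_sectionLaw p) (erasureMatrix_monotone hp A) C.zero_subset_backwardStep h) M {0}

theorem truncatedTransfer_univ_antitone (hp : ∀ l, p l ∈ Icc (0 : ℝ) 1) :
    Antitone fun N => C.truncatedTransfer l N univ univ p := by
  intro N M h
  simp only [truncatedTransfer_eq]
  refine (antitone_stepMatrix_pow_mulVec forwardStep_monotone (sectionLaw_nonneg hp)
    (sum_sectionLaw p) (backwardValue_mono hp M univ) subset_univ h).trans ?_
  exact stepMatrix_pow_mulVec_mono (sectionLaw_nonneg hp) (fun A =>
    antitone_stepMatrix_pow_mulVec backwardStep_monotone (sectionLaw_nonneg hp)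
      (sum_sectionLaw p) (erasureMatrix_monotone hp A) subset_univ h) N univ

theorem tendsto_forwardSteady (hp : ∀ l, p l ∈ Icc (0 : ℝ) 1) (A : Set C.State) :
    Tendsto (fun N => (stepMatrix C.forwardStep (sectionLaw p) ^ N) {0} A) atTop
      (𝓝 (C.forwardSteady (sectionLaw p) A)) := by
  obtain ⟨c, hc⟩ := exists_tendsto_stepMatrix_pow_apply forwardStep_monotone
    (sectionLaw_nonneg hp) (sum_sectionLaw p) C.zero_subset_forwardStep subset_univ A
  have : C.forwardSteady (sectionLaw p) A = c := by
    rw [forwardSteady, forwardMatrix_eq]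
    exact hc.limUnder_eq
  rwa [this]

theorem tendsto_backwardSteady (hp : ∀ l, p l ∈ Icc (0 : ℝ) 1) (B : Set C.State) :
    Tendsto (fun N => (stepMatrix C.backwardStep (sectionLaw p) ^ N) {0} B) atTop
      (𝓝 (C.backwardSteady (sectionLaw p) B)) := by
  obtain ⟨c, hc⟩ := exists_tendsto_stepMatrix_pow_apply backwardStep_monotone
    (sectionLaw_nonneg hp) (sum_sectionLaw p) C.zero_subset_backwardStep subset_univ B
  have : C.backwardSteady (sectionLaw p) B = c := by
    rw [backwardSteady, backwardMatrix_eq]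
    exact hc.limUnder_eq
  rwa [this]

end

theorem tendsto_truncatedTransfer_zero (hp : ∀ l, p l ∈ Icc (0 : ℝ) 1) :
    Tendsto (fun N => C.truncatedTransfer l N {0} {0} p) atTop (𝓝 (C.transfer l p)) := by
  simp only [truncatedTransfer, transfer, forwardMatrix_eq, backwardMatrix_eq]
  exact tendsto_finsetSum _ fun A _ => tendsto_finsetSum _ fun B _ =>
    ((tendsto_forwardSteady hp A).mul_const _).mul (tendsto_backwardSteady hp B)

/-- If no bit is erased for sure, the steady-state laws do not depend on the end metrics. -/
theorem tendsto_truncatedTransfer_univ (hp : ∀ l, p l ∈ Icc (0 : ℝ) 1) (hp1 : ∀ l, p l < 1) :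
    Tendsto (fun N => C.truncatedTransfer l N univ univ p) atTop (𝓝 (C.transfer l p)) := by
  simp only [truncatedTransfer, transfer, forwardMatrix_eq, backwardMatrix_eq]
  refine tendsto_finsetSum _ fun A _ => tendsto_finsetSum _ fun B _ =>
    (Tendsto.mul_const _ ?_).mul ?_
  · exact tendsto_stepMatrix_pow_apply_top forwardStep_monotone (sectionLaw_nonneg hp)
      (sum_sectionLaw p) C.zero_subset_forwardStep subset_univ C.iterate_forwardStep_empty
      (sectionLaw_empty_pos hp1) (tendsto_forwardSteady hp A)
  · exact tendsto_stepMatrix_pow_apply_top backwardStep_monotone (sectionLaw_nonneg hp)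
      (sum_sectionLaw p) C.zero_subset_backwardStep subset_univ C.iterate_backwardStep_empty
      (sectionLaw_empty_pos hp1) (tendsto_backwardSteady hp B)

theorem transfer_mem_Icc (hp : ∀ l, p l ∈ Icc (0 : ℝ) 1) : C.transfer l p ∈ Icc (0 : ℝ) 1 :=
  isClosed_Icc.mem_of_tendsto (tendsto_truncatedTransfer_zero hp)
    (Eventually.of_forall fun N => truncatedTransfer_mem_Icc hp N _ _)

theorem transfer_mono (hp : ∀ l, p l ∈ Icc (0 : ℝ) 1) (hp' : ∀ l, p' l ∈ Icc (0 : ℝ) 1)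
    (hle : ∀ l, p l ≤ p' l) : C.transfer l p ≤ C.transfer l p' :=
  le_of_tendsto_of_tendsto' (tendsto_truncatedTransfer_zero hp)
    (tendsto_truncatedTransfer_zero hp') fun N => truncatedTransfer_law_mono hp hp' hle N _ _

theorem truncatedTransfer_zero_le_transfer (hp : ∀ l, p l ∈ Icc (0 : ℝ) 1) (N : ℕ) :
    C.truncatedTransfer l N {0} {0} p ≤ C.transfer l p :=
  (truncatedTransfer_zero_monotone hp).ge_of_tendsto (tendsto_truncatedTransfer_zero hp) N

theorem transfer_le_truncatedTransfer_univ (hp : ∀ l, p l ∈ Icc (0 : ℝ) 1) (N : ℕ) :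
    C.transfer l p ≤ C.truncatedTransfer l N univ univ p :=
  -- Lower approximations increase and upper ones decrease, so lengths `M` and `N` are compared at
  -- `max N M`.
  le_of_tendsto' (tendsto_truncatedTransfer_zero hp) fun M =>
    (truncatedTransfer_zero_monotone hp (le_max_right N M)).trans <|
      (truncatedTransfer_zero_le_univ hp _).trans
        (truncatedTransfer_univ_antitone hp (le_max_left N M))

theorem continuous_sectionLaw_const (E : Finset (Fin (k + 1))) :
    Continuous fun x : ℝ => sectionLaw (fun _ => x) E := by
  unfold sectionLaw
  refine continuous_finsetProd _ fun l _ => ?_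
  split_ifs <;> fun_prop

theorem continuous_truncatedTransfer (N : ℕ) (A₀ B₀ : Set C.State) :
    Continuous fun x : ℝ => C.truncatedTransfer l N A₀ B₀ fun _ => x := by
  have hite : ∀ (P : Prop) [Decidable P] (E : Finset (Fin (k + 1))),
      Continuous fun x : ℝ => if P then sectionLaw (fun _ => x) E else 0 := fun P _ E => by
    split_ifs
    · exact continuous_sectionLaw_const E
    · exact continuous_const
  have hf : Continuous fun x : ℝ => C.forwardMatrix (sectionLaw fun _ => x) :=
    continuous_matrix fun A A' => continuous_finsetSum _ fun E _ => hite _ E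
  have hb : Continuous fun x : ℝ => C.backwardMatrix (sectionLaw fun _ => x) :=
    continuous_matrix fun A A' => continuous_finsetSum _ fun E _ => hite _ E
  unfold truncatedTransfer
  refine continuous_finsetSum _ fun A _ => continuous_finsetSum _ fun B _ => ?_
  refine (((hf.pow N).matrix_elem _ _).mul ?_).mul ((hb.pow N).matrix_elem _ _)
  simp only [erasureMatrix_eq]
  exact continuous_finsetSum _ fun E _ => (continuous_sectionLaw_const E).mul continuous_const

/-- The function is an increasing limit of the polynomials with zero end states, hence lower
semicontinuous; below 1 it is also a decreasing limit of those with unknown end states, hence upper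
semicontinuous. -/
theorem continuousOn_transfer_const : ContinuousOn (fun x => C.transfer l fun _ => x)
    (Icc (0 : ℝ) 1) := by
  intro x₀ hx₀
  refine tendsto_order.2 ⟨fun a ha => ?_, fun b hb => ?_⟩
  · obtain ⟨N, hN⟩ := ((tendsto_truncatedTransfer_zero fun _ => hx₀).eventually_const_lt ha).exists
    filter_upwards [(continuous_truncatedTransfer N {0} {0}).continuousWithinAt.eventually_const_lt
      hN, self_mem_nhdsWithin] with x hx hx01
    exact hx.trans_le (truncatedTransfer_zero_le_transfer (fun _ => hx01) N)
  · rcases hx₀.2.lt_or_eq with h1 | rfl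
    · obtain ⟨N, hN⟩ := ((tendsto_truncatedTransfer_univ (fun _ => hx₀)
        fun _ => h1).eventually_lt_const hb).exists
      filter_upwards [(continuous_truncatedTransfer N univ
        univ).continuousWithinAt.eventually_lt_const hN, self_mem_nhdsWithin] with x hx hx01
      exact (transfer_le_truncatedTransfer_univ (fun _ => hx01) N).trans_lt hx
    -- At 1 the two limits may differ, but there the value is the maximum by monotonicity.
    · filter_upwards [self_mem_nhdsWithin] with x hx01
      exact (transfer_mono (fun _ => hx01) (fun _ => hx₀) fun _ => hx01.2).trans_lt hb

end

/-! ### Zeros of the transfer functions. -/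

section Vanishing

variable {k : ℕ} (C : SystematicEncoder k)

theorem forwardSteady_eq_zero {μ : Finset (Fin (k + 1)) → ℝ} {P : Set C.State → Prop} (h0 : P {0})
    (hP : ∀ E A, μ E ≠ 0 → P A → P (C.forwardStep E A)) {A : Set C.State} (hA : ¬ P A) :
    C.forwardSteady μ A = 0 := by
  simp only [forwardSteady, forwardMatrix_eq, stepMatrix_pow_apply_eq_zero hP _ h0 hA]
  exact tendsto_const_nhds.limUnder_eq

theorem backwardSteady_eq_zero {μ : Finset (Fin (k + 1)) → ℝ} {Q : Set C.State → Prop} (h0 : Q {0})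
    (hQ : ∀ E B, μ E ≠ 0 → Q B → Q (C.backwardStep E B)) {B : Set C.State} (hB : ¬ Q B) :
    C.backwardSteady μ B = 0 := by
  simp only [backwardSteady, backwardMatrix_eq, stepMatrix_pow_apply_eq_zero hQ _ h0 hB]
  exact tendsto_const_nhds.limUnder_eq

/-- The transfer function vanishes if invariants of the metrics exclude extrinsic erasures. -/
theorem transfer_eq_zero_of_invariant {l : Fin (k + 1)} {p : Fin (k + 1) → ℝ}
    {P Q : Set C.State → Prop} (hP0 : P {0}) (hQ0 : Q {0})
    (hP : ∀ E A, sectionLaw p E ≠ 0 → P A → P (C.forwardStep E A))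
    (hQ : ∀ E B, sectionLaw p E ≠ 0 → Q B → Q (C.backwardStep E B))
    (h : ∀ E A B, sectionLaw p E ≠ 0 → P A → Q B → ¬ C.ExtrinsicErased l E A B) :
    C.transfer l p = 0 := by
  refine Finset.sum_eq_zero fun A _ => Finset.sum_eq_zero fun B _ => ?_
  by_cases hA : P A
  · by_cases hB : Q B
    · rw [erasureMatrix_eq, Finset.sum_eq_zero, mul_zero, zero_mul]
      intro E _
      by_cases hE : sectionLaw p E = 0
      · rw [hE, zero_mul]
      · rw [erasedIndicator, if_neg (h E A B hE hA hB), mul_zero]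
    · rw [C.backwardSteady_eq_zero hQ0 hQ hB, mul_zero]
  · rw [C.forwardSteady_eq_zero hP0 hP hA, zero_mul, zero_mul]

/-- The state as a power series in the delay. -/
noncomputable def stateSeries (s : C.State) : PowerSeries (ZMod 2) := PowerSeries.mk (C.register s)

theorem stateSeries_zero : C.stateSeries 0 = 0 := by
  ext i
  simp [stateSeries, register_zero]

/-- The trellis section as one identity of power series. Its constant term is the definition of the
parity bit: `feedback` has constant term 1 and the parity cancels itself in characteristic 2. -/
theorem X_mul_stateSeries_nextState (s : C.State) (u : Fin k → ZMod 2) :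
    PowerSeries.X * C.stateSeries (C.nextState s u) = C.stateSeries s
      + ∑ j, (C.feedforward j : PowerSeries (ZMod 2)) * PowerSeries.C (u j)
      + (C.feedback : PowerSeries (ZMod 2)) * PowerSeries.C (C.parity s u) := by
  ext i
  cases i with
  | zero =>
    simp only [map_add, map_sum, PowerSeries.coeff_mul_C, Polynomial.coeff_coe,
      PowerSeries.coeff_zero_X_mul, stateSeries, PowerSeries.coeff_mk, C.feedback_coeff_zero,
      one_mul]
    exact (CharTwo.add_self_eq_zero (C.parity s u)).symm
  | succ i =>
    simp only [map_add, map_sum, PowerSeries.coeff_mul_C, Polynomial.coeff_coe,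
      PowerSeries.coeff_succ_X_mul, stateSeries, PowerSeries.coeff_mk, register_nextState]

end Vanishing

section RateHalf

variable {C : SystematicEncoder 1}

/-- A zero numerator would be divisible by `feedback`. The nonzero numerator can be cancelled below.
-/
theorem IsRecursive.feedforward_ne_zero (hC : C.IsRecursive) : C.feedforward 0 ≠ 0 := by
  obtain ⟨j, hj⟩ := hC
  rw [Subsingleton.elim j 0] at hj
  rintro h
  exact hj (h ▸ dvd_zero _)

/-- If all parity bits are known, so are the systematic bits. -/
theorem IsRecursive.transfer_systematic_eq_zero (hC : C.IsRecursive) (x : ℝ) :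
    C.transfer 0 ![x, 0] = 0 := by
  set n : PowerSeries (ZMod 2) := (C.feedforward 0 : PowerSeries (ZMod 2)) with hn
  have hn0 : n ≠ 0 := fun h => hC.feedforward_ne_zero (Polynomial.coe_eq_zero_iff.1 h)
  have hE : ∀ E, sectionLaw ![x, 0] E ≠ 0 → Fin.last 1 ∉ E := fun E h hl =>
    h (sectionLaw_eq_zero (l := Fin.last 1) rfl hl)
  have hstep : ∀ E s u, Fin.last 1 ∉ E → C.Compatible E s u →
      PowerSeries.X * C.stateSeries (C.nextState s u) =
        C.stateSeries s + n * PowerSeries.C (u 0) := fun E s u hl hc => by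
    rw [X_mul_stateSeries_nextState, C.parity_eq_zero_of_compatible hc hl]
    simp [hn]
  -- `P`: the state is reached from zero by inputs `U` of degree less than `t` with all parities
  -- zero. `Q`: a zero-parity path from the state to zero forces its series to be a multiple of `n`.
  refine C.transfer_eq_zero_of_invariant
    (P := fun A => ∀ s ∈ A, ∃ (t : ℕ) (U : PowerSeries (ZMod 2)),
      (∀ i ≥ t, PowerSeries.coeff i U = 0) ∧ PowerSeries.X ^ t * C.stateSeries s = n * U)
    (Q := fun B => ∀ s ∈ B, n ∣ C.stateSeries s) ?_ ?_ ?_ ?_ ?_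
  · rintro _ rfl
    exact ⟨0, 0, by simp, by simp [stateSeries_zero]⟩
  · rintro _ rfl
    rw [stateSeries_zero]
    exact dvd_zero _
  · rintro E A h hA _ ⟨s, hs, u, hu, rfl⟩
    obtain ⟨t, U, hU, hs⟩ := hA s hs
    refine ⟨t + 1, U + PowerSeries.X ^ t * PowerSeries.C (u 0), fun i hi => ?_, ?_⟩
    · rw [map_add, hU i (by omega), zero_add, PowerSeries.coeff_mul_C, PowerSeries.coeff_X_pow,
        if_neg (by omega), zero_mul]
    · rw [pow_succ, mul_assoc, hstep E s u (hE E h) hu, mul_add, hs]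
      ring
  · rintro E B h hB s ⟨u, hu, hs⟩
    have h1 := hstep E s u (hE E h) hu
    have h2 : n ∣ C.stateSeries s + n * PowerSeries.C (u 0) :=
      h1 ▸ Dvd.dvd.mul_left (hB _ hs) _
    exact (dvd_add_left (dvd_mul_right _ _)).1 h2
  · rintro E A B h hA hB ⟨s, hs, u, hu, hl, hs'⟩
    obtain ⟨t, U, hU, hs⟩ := hA s hs
    obtain ⟨W, hW⟩ := hB _ hs'
    have hu0 : u 0 = 1 := by
      rw [← hl]
      exact (Fin.snoc_castSucc (α := fun _ => ZMod 2) _ _ (0 : Fin 1)).symm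
    have h1 := hstep (insert 0 E) s u (by
      rw [Finset.mem_insert, not_or]
      exact ⟨by decide, hE E h⟩) hu
    rw [hu0, map_one, mul_one, hW] at h1
    -- After cancelling `n`, the coefficient of `X ^ t` is 0 on the left and 1 on the right.
    have h2 : n * (PowerSeries.X ^ (t + 1) * W) = n * (U + PowerSeries.X ^ t) := by
      calc _ = PowerSeries.X ^ t * (PowerSeries.X * (n * W)) := by ring
        _ = _ := by rw [h1, mul_add, hs]; ring
    have h3 := congrArg (PowerSeries.coeff t) (mul_left_cancel₀ hn0 h2)
    rw [map_add, hU t le_rfl, PowerSeries.coeff_X_pow_self, PowerSeries.coeff_X_pow_mul',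
      if_neg (by omega)] at h3
    exact absurd h3 (by decide)

end RateHalf

/-- If all other bits are known, so are the parity bits. -/
theorem transfer_last_zero {k : ℕ} (C : SystematicEncoder k) :
    C.transfer (Fin.last k) (fun _ => 0) = 0 := by
  have hE : ∀ E : Finset (Fin (k + 1)), sectionLaw (fun _ => 0) E ≠ 0 → E = ∅ := fun E h =>
    Finset.eq_empty_of_forall_notMem fun l hl => h (sectionLaw_eq_zero (l := l) rfl hl)
  -- State and inputs are known to be zero, which already determines the parity; the backward metric
  -- is irrelevant.
  refine C.transfer_eq_zero_of_invariant (P := fun A => A ⊆ {0}) (Q := fun _ => True) subset_rfl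
    trivial ?_ (fun _ _ _ _ => trivial) ?_
  · rintro E A h hA _ ⟨s, hs, u, hu, rfl⟩
    obtain rfl := hE E h
    obtain rfl := hA hs
    have : u = 0 := funext fun j => C.input_eq_zero_of_compatible hu (by simp)
    rw [this, nextState_zero]
    rfl
  · rintro E A B h hA _ ⟨s, hs, u, hu, hl, -⟩
    obtain rfl := hE E h
    obtain rfl := hA hs
    have : u = 0 := funext fun j => C.input_eq_zero_of_compatible hu (by
      simp [Fin.castSucc_ne_last])
    rw [label, Fin.snoc_last, this, parity_zero] at hl
    exact absurd hl (by decide)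

/-! ### Averaging over the order of the code bits. -/

section TimeVarying

variable {k : ℕ} (B : SystematicEncoder k)

/-- Left multiplication by a transposition shows that the sum does not depend on `a`; summing over
all `a` gives `∑ l, F l` for each `σ`. -/
theorem sum_perm_inv_apply {ι : Type*} [Fintype ι] [DecidableEq ι] (F : ι → ℝ) (a : ι) :
    (Fintype.card ι : ℝ) * ∑ σ : Equiv.Perm ι, F (σ⁻¹ a) =
      (Nat.factorial (Fintype.card ι) : ℝ) * ∑ l, F l := by
  have h1 : ∀ b, ∑ σ : Equiv.Perm ι, F (σ⁻¹ b) = ∑ σ : Equiv.Perm ι, F (σ⁻¹ a) := fun b => by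
    rw [← Equiv.sum_comp (Equiv.mulLeft (Equiv.swap a b)) fun σ => F (σ⁻¹ b)]
    simp only [Equiv.coe_mulLeft, mul_inv_rev, Equiv.Perm.mul_apply, Equiv.swap_inv,
      Equiv.swap_apply_right]
  have h2 : ∑ b, ∑ σ : Equiv.Perm ι, F (σ⁻¹ b) =
      ∑ σ : Equiv.Perm ι, ∑ l, F l := by
    rw [Finset.sum_comm]
    exact Finset.sum_congr rfl fun σ _ => Equiv.sum_comp σ⁻¹ F
  simpa only [h1, Finset.sum_const, Finset.card_univ, nsmul_eq_mul, Fintype.card_perm] using h2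

theorem mixedLaw_const (y : ℝ) : mixedLaw (fun _ : Fin (k + 1) => y) = sectionLaw fun _ => y := by
  funext E
  have : (Nat.factorial (k + 1) : ℝ) ≠ 0 := by positivity
  simp only [mixedLaw, Finset.sum_const, Finset.card_univ, Fintype.card_perm, Fintype.card_fin,
    nsmul_eq_mul]
  field_simp

/-- For equal erasure probabilities the random order averages the transfer functions. -/
theorem mixedTransfer_const (a : Fin (k + 1)) (y : ℝ) :
    B.mixedTransfer a (fun _ => y) = B.averageTransfer fun _ => y := by
  have h1 : (Nat.factorial (k + 1) : ℝ) ≠ 0 := by positivity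
  have h2 : (k : ℝ) + 1 ≠ 0 := by positivity
  have key : ∀ F : Fin (k + 1) → ℝ, (∑ σ : Equiv.Perm (Fin (k + 1)), F (σ⁻¹ a)) /
      (Nat.factorial (k + 1) : ℝ) = (∑ l, F l) / ((k : ℝ) + 1) := fun F => by
    have := sum_perm_inv_apply F a
    rw [Fintype.card_fin] at this
    push_cast at this
    rw [div_eq_div_iff h1 h2]
    linarith
  simp only [mixedTransfer, mixedLaw_const, averageTransfer, transfer]
  rw [Finset.sum_comm (s := Finset.univ (α := Fin (k + 1))), Finset.sum_div]
  refine Finset.sum_congr rfl fun A _ => ?_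
  rw [Finset.sum_comm (s := Finset.univ (α := Fin (k + 1))), Finset.sum_div]
  refine Finset.sum_congr rfl fun A' _ => ?_
  rw [key fun l => B.erasureMatrix (sectionLaw fun _ => y) l A A', ← Finset.sum_mul,
    ← Finset.mul_sum]
  ring

end TimeVarying

end SystematicEncoder

/-! ### Reduction of density evolution to the scalar coupled recursion. -/

section Reduction

theorem onChain_const_mul (L : ℕ) (e : ℝ) (a : ℤ → ℝ) (r : ℤ) :
    onChain L (fun _ => e) r * a r = e * onChain L a r := by
  unfold onChain
  split_ifs <;> simp

theorem onChain_onChain_mul (L : ℕ) (e : ℝ) (a : ℤ → ℝ) (r : ℤ) :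
    onChain L (fun _ => e) r * a r = onChain L (fun s => e * a s) r := by
  unfold onChain
  split_ifs <;> simp

variable {C : SystematicEncoder 1}

theorem pccMessage_lower (m L : ℕ) (e₀ e₁ : ℝ) (i : ℕ) :
    pccMessage (fun _ => C) m L e₀ e₁ i .lower = pccMessage (fun _ => C) m L e₀ e₁ i .upper := by
  induction i with
  | zero => rfl
  | succ i ih => simp only [pccMessage, Component.other, ih]

theorem pccToInfo_upper_eq_lower (m L : ℕ) (e₀ e₁ : ℝ) (i : ℕ) :
    pccToInfo (fun _ => C) m L e₀ e₁ i .upper = pccToInfo (fun _ => C) m L e₀ e₁ i .lower := by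
  rw [pccToInfo, pccToInfo, pccMessage_lower]

/-- Off the chain the parity bits are known, so `transfer_systematic_eq_zero` kills the messages
there; this is the mask on `f`. -/
theorem onChain_pccToInfo_succ (hC : C.IsRecursive) (m L : ℕ) (e₀ e₁ : ℝ) (i : ℕ) :
    onChain L (pccToInfo (fun _ => C) m L e₀ e₁ (i + 1) .upper) =
      onChain L (forwardAvg m (onChain L fun s => C.transfer 0
        ![e₀ * backwardAvg m (onChain L (pccToInfo (fun _ => C) m L e₀ e₁ i .upper)) s, e₁])) := by
  have : pccMessage (fun _ => C) m L e₀ e₁ (i + 1) .upper 0 = onChain L fun s => C.transfer 0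
      ![e₀ * backwardAvg m (onChain L (pccToInfo (fun _ => C) m L e₀ e₁ i .upper)) s, e₁] := by
    funext s
    simp only [pccMessage, Component.other, pccMessage_lower, onChain_const_mul,
      backwardAvg_const_mul]
    by_cases hs : 1 ≤ s ∧ s ≤ (L : ℤ)
    · simp only [onChain, if_pos hs, pccToInfo]
    · simp only [onChain, if_neg hs, hC.transfer_systematic_eq_zero]
  rw [pccToInfo, this]

/-- The inner messages vanish off the chain as for PCCs. Since `e₀` is common to the information and
outer parity bits, it factors out of both averages. -/
theorem sccToOuter_succ (hC : C.IsRecursive) (m L : ℕ) (e₀ e₂ : ℝ) (i : ℕ) :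
    sccToOuter C C m L e₀ e₀ e₂ (i + 1) =
      onChain L (forwardAvg m (onChain L fun s => e₀ * C.transfer 0
        ![e₀ * backwardAvg m (fun r =>
          (C.transfer 0 ![sccToOuter C C m L e₀ e₀ e₂ i r, sccToOuter C C m L e₀ e₀ e₂ i r] +
            C.transfer 1 ![sccToOuter C C m L e₀ e₀ e₂ i r, sccToOuter C C m L e₀ e₀ e₂ i r]) / 2)
          s, e₂])) := by
  have hz : ![(0 : ℝ), 0] = fun _ => 0 := by
    funext l; fin_cases l <;> rfl
  have h1 : C.transfer 1 ![0, 0] = 0 := by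
    rw [hz]
    exact C.transfer_last_zero
  have : sccInner C C m L e₀ e₀ e₂ (i + 1) 0 = onChain L fun s => C.transfer 0
      ![e₀ * backwardAvg m (fun r =>
          (C.transfer 0 ![sccToOuter C C m L e₀ e₀ e₂ i r, sccToOuter C C m L e₀ e₀ e₂ i r] +
            C.transfer 1 ![sccToOuter C C m L e₀ e₀ e₂ i r, sccToOuter C C m L e₀ e₀ e₂ i r]) / 2)
          s, e₂] := by
    funext s
    simp only [sccInner, ← backwardAvg_const_mul]
    by_cases hs : 1 ≤ s ∧ s ≤ (L : ℤ)
    · simp only [onChain, if_pos hs]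
      congr 3
      funext r
      simp only [sccOuter, sccToOuter, onChain]
      -- Off the chain the mask on the left is matched on the right by the vanishing of both outer
      -- transfer functions at `(0, 0)`.
      split_ifs
      · ring
      · simp only [zero_mul, hC.transfer_systematic_eq_zero, h1]
        simp
    · simp only [onChain, if_neg hs, hC.transfer_systematic_eq_zero]
  funext t
  rw [sccToOuter, this, onChain_onChain_mul]
  unfold onChain
  split_ifs
  · simp only [← forwardAvg_const_mul]
    refine forwardAvg_congr fun j _ => ?_
    simp only [mul_ite, mul_zero]
  · rfl

variable {B : SystematicEncoder 2}

theorem vec_three_const (y : ℝ) : ![y, y, y] = fun _ => y := by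
  funext l; fin_cases l <;> rfl

/-- If all messages of an iteration agree, every node sees three equal arguments, at which
`mixedTransfer` is the same for all edges. -/
theorem bccMessage_eq (m L : ℕ) (e : ℝ) (i : ℕ) (c : Component) (a : Fin 3) :
    bccMessage (fun _ => B) m L e i c a = bccMessage (fun _ => B) m L e i .upper 0 := by
  induction i generalizing c a with
  | zero => rfl
  | succ i ih =>
    funext t
    simp only [bccMessage]
    simp only [ih, SystematicEncoder.mixedTransfer_const]

theorem bccToSymbol_eq (m L : ℕ) (e : ℝ) (i : ℕ) (c : Component) (a : Fin 3) :
    bccToSymbol (fun _ => B) m L e i c a = bccToSymbol (fun _ => B) m L e i .upper 0 := by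
  rw [bccToSymbol, bccMessage_eq, bccToSymbol]

/-- No vanishing is needed here: symbols of times `1, …, L` meet only factor nodes of times `1, …, L
+ m`, so the mask of length `L + m` is never active. -/
theorem onChain_bccToSymbol_succ (m L : ℕ) (e : ℝ) (i : ℕ) :
    onChain L (bccToSymbol (fun _ => B) m L e (i + 1) .upper 0) =
      onChain L (forwardAvg m (onChain (L + m) fun s =>
        (fun y => B.averageTransfer ![e * y, e * y, e * y])
          (backwardAvg m (onChain L (bccToSymbol (fun _ => B) m L e i .upper 0)) s))) := by
  funext t
  unfold onChain
  split_ifs with ht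
  · refine forwardAvg_congr fun j hj => ?_
    rw [if_pos ⟨by omega, by push_cast; omega⟩]
    simp only [bccMessage]
    simp only [bccMessage_eq, SystematicEncoder.mixedTransfer_const, onChain_const_mul,
      backwardAvg_const_mul, vec_three_const]
    rfl
  · rfl

end Reduction

/-! ### The systems satisfy the hypotheses of threshold saturation. -/

section ComponentSystems

open SystematicEncoder

theorem puncture_mem_Icc {ρ ε : ℝ} (hρ : ρ ∈ Icc (0 : ℝ) 1) (hε : ε ∈ Icc (0 : ℝ) 1) :
    puncture ρ ε ∈ Icc (0 : ℝ) 1 := by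
  have h1 := mul_nonneg (sub_nonneg.2 hε.2) hρ.1
  have h2 := mul_le_one₀ (by linarith [hε.1] : 1 - ε ≤ 1) hρ.1 hρ.2
  constructor <;> unfold puncture <;> linarith

theorem puncture_mono {ρ : ℝ} (hρ : ρ ∈ Icc (0 : ℝ) 1) : Monotone (puncture ρ) := fun x y h => by
  have := mul_le_mul_of_nonneg_right h hρ.1
  unfold puncture
  linarith

theorem mul_mem_unitIcc {a b : ℝ} (ha : a ∈ Icc (0 : ℝ) 1)
    (hb : b ∈ Icc (0 : ℝ) 1) : a * b ∈ Icc (0 : ℝ) 1 :=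
  ⟨mul_nonneg ha.1 hb.1, mul_le_one₀ ha.2 hb.1 hb.2⟩

theorem vec_two_mem_Icc {a b : ℝ} (ha : a ∈ Icc (0 : ℝ) 1) (hb : b ∈ Icc (0 : ℝ) 1) :
    ∀ l, (![a, b] : Fin 2 → ℝ) l ∈ Icc (0 : ℝ) 1 := by
  intro l
  fin_cases l
  · exact ha
  · exact hb

theorem vec_two_le {a b a' b' : ℝ} (ha : a ≤ a') (hb : b ≤ b') :
    ∀ l, (![a, b] : Fin 2 → ℝ) l ≤ (![a', b'] : Fin 2 → ℝ) l := by
  intro l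
  fin_cases l
  · exact ha
  · exact hb

theorem averageTransfer_mem_Icc {k : ℕ} (B : SystematicEncoder k) {y : ℝ}
    (hy : y ∈ Icc (0 : ℝ) 1) : B.averageTransfer (fun _ => y) ∈ Icc (0 : ℝ) 1 := by
  have h2 : (0 : ℝ) < (k : ℝ) + 1 := by positivity
  have h := fun l => transfer_mem_Icc (C := B) (l := l) (p := fun _ => y) fun _ => hy
  refine ⟨div_nonneg (Finset.sum_nonneg fun l _ => (h l).1) h2.le, (div_le_one h2).2 ?_⟩
  refine (Finset.sum_le_sum fun l _ => (h l).2).trans ?_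
  simp

theorem averageTransfer_mono {k : ℕ} (B : SystematicEncoder k) {y y' : ℝ}
    (hy : y ∈ Icc (0 : ℝ) 1) (hy' : y' ∈ Icc (0 : ℝ) 1) (h : y ≤ y') :
    B.averageTransfer (fun _ => y) ≤ B.averageTransfer (fun _ => y') := by
  unfold averageTransfer
  gcongr with l _
  exact transfer_mono (fun _ => hy) (fun _ => hy') fun _ => h

variable (C : SystematicEncoder 1) (B : SystematicEncoder 2)
  {e e₀ e₁ : ℝ → ℝ}

/-- A system whose first function has the form `s (ε) f_s (e₀ (ε) y, e₁ (ε))`. -/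
theorem thresholdSaturation_transfer {s g : ℝ → ℝ}
    (hs : ∀ ε ∈ Icc (0 : ℝ) 1, s ε ∈ Icc (0 : ℝ) 1) (hsm : Monotone s)
    (h₀ : ∀ ε ∈ Icc (0 : ℝ) 1, e₀ ε ∈ Icc (0 : ℝ) 1) (h₀m : Monotone e₀)
    (h₁ : ∀ ε ∈ Icc (0 : ℝ) 1, e₁ ε ∈ Icc (0 : ℝ) 1) (h₁m : Monotone e₁)
    (hg01 : ∀ y ∈ Icc (0 : ℝ) 1, g y ∈ Icc (0 : ℝ) 1)
    (hg : MonotoneOn g (Icc 0 1)) (hgc : ContinuousOn g (Icc 0 1)) (hg0 : g 0 = 0) :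
    ThresholdSaturation (fun y ε => s ε * C.transfer 0 ![e₀ ε * y, e₁ ε]) g := by
  have hp : ∀ ε ∈ Icc (0 : ℝ) 1, ∀ y ∈ Icc (0 : ℝ) 1, ∀ l,
      (![e₀ ε * y, e₁ ε] : Fin 2 → ℝ) l ∈ Icc (0 : ℝ) 1 := fun ε hε y hy =>
    vec_two_mem_Icc (mul_mem_unitIcc (h₀ ε hε) hy) (h₁ ε hε)
  refine thresholdSaturation_of_monotone (fun ε hε y hy => mul_mem_unitIcc (hs ε hε)
    (transfer_mem_Icc (hp ε hε y hy))) (fun ε hε y hy y' hy' h => ?_)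
    (fun y hy ε hε ε' hε' h => ?_) hg01 hg hgc hg0
  · exact mul_le_mul_of_nonneg_left (transfer_mono (hp ε hε y hy) (hp ε hε y' hy')
      (vec_two_le (mul_le_mul_of_nonneg_left h (h₀ ε hε).1) le_rfl)) (hs ε hε).1
  · exact mul_le_mul (hsm h) (transfer_mono (hp ε hε y hy) (hp ε' hε' y hy)
      (vec_two_le (mul_le_mul_of_nonneg_right (h₀m h) hy.1) (h₁m h)))
      (transfer_mem_Icc (hp ε hε y hy)).1 (hs ε' hε').1

theorem thresholdSaturation_pcc
    (h₀ : ∀ ε ∈ Icc (0 : ℝ) 1, e₀ ε ∈ Icc (0 : ℝ) 1) (h₀m : Monotone e₀)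
    (h₁ : ∀ ε ∈ Icc (0 : ℝ) 1, e₁ ε ∈ Icc (0 : ℝ) 1) (h₁m : Monotone e₁) :
    ThresholdSaturation (fun y ε => C.transfer 0 ![e₀ ε * y, e₁ ε]) (fun x => x) := by
  have := thresholdSaturation_transfer C (s := fun _ => 1) (g := fun x => x) (by simp)
    monotone_const h₀ h₀m h₁ h₁m (fun _ h => h) (fun _ _ _ _ h => h) continuousOn_id rfl
  simpa only [one_mul] using this

-- The outer function `g` inherits its regularity from the transfer functions on the diagonal; `g 0
-- = 0` combines the vanishing of the systematic and of the parity output.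
variable {C} in
theorem thresholdSaturation_scc (hC : C.IsRecursive)
    (h₀ : ∀ ε ∈ Icc (0 : ℝ) 1, e₀ ε ∈ Icc (0 : ℝ) 1) (h₀m : Monotone e₀)
    (h₁ : ∀ ε ∈ Icc (0 : ℝ) 1, e₁ ε ∈ Icc (0 : ℝ) 1) (h₁m : Monotone e₁) :
    ThresholdSaturation (fun y ε => e₀ ε * C.transfer 0 ![e₀ ε * y, e₁ ε])
      (fun x => (C.transfer 0 ![x, x] + C.transfer 1 ![x, x]) / 2) := by
  have hv : ∀ x : ℝ, ![x, x] = fun _ : Fin 2 => x := fun x => by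
    funext l; fin_cases l <;> rfl
  refine thresholdSaturation_transfer C h₀ h₀m h₀ h₀m h₁ h₁m (fun x hx => ?_)
    (fun x hx y hy h => ?_) ?_ ?_
  · have ha := transfer_mem_Icc (C := C) (l := 0) (vec_two_mem_Icc hx hx)
    have hb := transfer_mem_Icc (C := C) (l := 1) (vec_two_mem_Icc hx hx)
    constructor <;> linarith [ha.1, ha.2, hb.1, hb.2]
  · have ha := transfer_mono (C := C) (l := 0) (vec_two_mem_Icc hx hx) (vec_two_mem_Icc hy hy)
      (vec_two_le h h)
    have hb := transfer_mono (C := C) (l := 1) (vec_two_mem_Icc hx hx) (vec_two_mem_Icc hy hy)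
      (vec_two_le h h)
    linarith
  · simp only [hv]
    exact (continuousOn_transfer_const.add continuousOn_transfer_const).div_const 2
  · have h1 : C.transfer 1 ![0, 0] = 0 := by
      rw [hv]
      exact C.transfer_last_zero
    simp only [hC.transfer_systematic_eq_zero, h1]
    norm_num

theorem thresholdSaturation_bcc (h : ∀ ε ∈ Icc (0 : ℝ) 1, e ε ∈ Icc (0 : ℝ) 1) (hm : Monotone e) :
    ThresholdSaturation (fun y ε => B.averageTransfer ![e ε * y, e ε * y, e ε * y])
      (fun x => x) := by
  simp only [vec_three_const]
  have hp := fun ε hε y hy => mul_mem_unitIcc (b := y) (h ε hε) hy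
  refine thresholdSaturation_of_monotone
    (fun ε hε y hy => averageTransfer_mem_Icc B (hp ε hε y hy))
    (fun ε hε y hy y' hy' hle => ?_) (fun y hy ε hε ε' hε' hle => ?_)
    (fun _ h => h) (fun _ _ _ _ h => h) continuousOn_id rfl
  · exact averageTransfer_mono B (hp ε hε y hy) (hp ε hε y' hy')
      (mul_le_mul_of_nonneg_left hle (h ε hε).1)
  · exact averageTransfer_mono B (hp ε hε y hy) (hp ε' hε' y hy)
      (mul_le_mul_of_nonneg_right (hm hle) hy.1)

end ComponentSystems

end SCTurbo

theorem mainTheorem1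
    -- identical rate-1/2 component encoders `C` (PCC, SCC), rate-2/3 component encoders `B` (BCC)
    (C : SystematicEncoder 1) (hC : C.IsRecursive)
    (B : SystematicEncoder 2) (hB : B.IsRecursive) :
    -- SC-PCC
    (∀ f : ℝ → ℝ → ℝ, f = (fun y ε => C.transfer 0 ![ε * y, ε]) →
      (∀ ε ∈ Set.Icc (0 : ℝ) 1, ∀ m L i : ℕ,
        pccToInfo (fun _ => C) m L ε ε i .upper = pccToInfo (fun _ => C) m L ε ε i .lower ∧
        onChain L (pccToInfo (fun _ => C) m L ε ε (i + 1) .upper) =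
          coupledStep f (fun x => x) ε m L L
            (onChain L (pccToInfo (fun _ => C) m L ε ε i .upper))) ∧
      ThresholdSaturation f (fun x => x)) ∧
    -- SC-SCC
    (∀ (f : ℝ → ℝ → ℝ) (g : ℝ → ℝ), f = (fun y ε => ε * C.transfer 0 ![ε * y, ε]) →
      g = (fun x => (C.transfer 0 ![x, x] + C.transfer 1 ![x, x]) / 2) →
      (∀ ε ∈ Set.Icc (0 : ℝ) 1, ∀ m L i : ℕ,
        sccToOuter C C m L ε ε ε (i + 1) =
          coupledStep f g ε m L L (sccToOuter C C m L ε ε ε i)) ∧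
      ThresholdSaturation f g) ∧
    -- modified SC-BCC with time-varying trellises
    (∀ f : ℝ → ℝ → ℝ, f = (fun y ε => B.averageTransfer ![ε * y, ε * y, ε * y]) →
      (∀ ε ∈ Set.Icc (0 : ℝ) 1, ∀ m L i : ℕ,
        (∀ c a, bccToSymbol (fun _ => B) m L ε i c a =
          bccToSymbol (fun _ => B) m L ε i .upper 0) ∧
        onChain L (bccToSymbol (fun _ => B) m L ε (i + 1) .upper 0) =
          coupledStep f (fun x => x) ε m L (L + m)
            (onChain L (bccToSymbol (fun _ => B) m L ε i .upper 0))) ∧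
      ThresholdSaturation f (fun x => x)) ∧
    -- SC-PCC, parity bits punctured with permeability rate `ρ`
    (∀ ρ ∈ Set.Icc (0 : ℝ) 1, ∀ f : ℝ → ℝ → ℝ,
      f = (fun y ε => C.transfer 0 ![ε * y, puncture ρ ε]) →
      (∀ ε ∈ Set.Icc (0 : ℝ) 1, ∀ m L i : ℕ,
        pccToInfo (fun _ => C) m L ε (puncture ρ ε) i .upper =
          pccToInfo (fun _ => C) m L ε (puncture ρ ε) i .lower ∧
        onChain L (pccToInfo (fun _ => C) m L ε (puncture ρ ε) (i + 1) .upper) =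
          coupledStep f (fun x => x) ε m L L
            (onChain L (pccToInfo (fun _ => C) m L ε (puncture ρ ε) i .upper))) ∧
      ThresholdSaturation f (fun x => x)) ∧
    -- SC-SCC, information and outer parity bits punctured with permeability rate `ρ₁`,
    -- inner parity bits with permeability rate `ρ₂`
    (∀ ρ₁ ∈ Set.Icc (0 : ℝ) 1, ∀ ρ₂ ∈ Set.Icc (0 : ℝ) 1, ∀ (f : ℝ → ℝ → ℝ) (g : ℝ → ℝ),
      f = (fun y ε => puncture ρ₁ ε * C.transfer 0 ![puncture ρ₁ ε * y, puncture ρ₂ ε]) →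
      g = (fun x => (C.transfer 0 ![x, x] + C.transfer 1 ![x, x]) / 2) →
      (∀ ε ∈ Set.Icc (0 : ℝ) 1, ∀ m L i : ℕ,
        sccToOuter C C m L (puncture ρ₁ ε) (puncture ρ₁ ε) (puncture ρ₂ ε) (i + 1) =
          coupledStep f g ε m L L
            (sccToOuter C C m L (puncture ρ₁ ε) (puncture ρ₁ ε) (puncture ρ₂ ε) i)) ∧
      ThresholdSaturation f g) ∧
    -- modified SC-BCC with time-varying trellises, all bits punctured with permeability rate `ρ`
    (∀ ρ ∈ Set.Icc (0 : ℝ) 1, ∀ f : ℝ → ℝ → ℝ,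
      f = (fun y ε => B.averageTransfer
        ![puncture ρ ε * y, puncture ρ ε * y, puncture ρ ε * y]) →
      (∀ ε ∈ Set.Icc (0 : ℝ) 1, ∀ m L i : ℕ,
        (∀ c a, bccToSymbol (fun _ => B) m L (puncture ρ ε) i c a =
          bccToSymbol (fun _ => B) m L (puncture ρ ε) i .upper 0) ∧
        onChain L (bccToSymbol (fun _ => B) m L (puncture ρ ε) (i + 1) .upper 0) =
          coupledStep f (fun x => x) ε m L (L + m)
            (onChain L (bccToSymbol (fun _ => B) m L (puncture ρ ε) i .upper 0))) ∧
      ThresholdSaturation f (fun x => x)) := by 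
  have hid : ∀ ε ∈ Set.Icc (0 : ℝ) 1, (fun ε => ε) ε ∈ Set.Icc (0 : ℝ) 1 := fun _ h => h
  have hidm : Monotone fun ε : ℝ => ε := fun _ _ h => h
  refine ⟨?_, ?_, ?_, ?_, ?_, ?_⟩
  · rintro _ rfl
    exact ⟨fun ε _ m L i => ⟨pccToInfo_upper_eq_lower m L ε ε i, onChain_pccToInfo_succ hC m L ε ε i⟩,
      thresholdSaturation_pcc C hid hidm hid hidm⟩
  · rintro _ _ rfl rfl
    exact ⟨fun ε _ m L i => sccToOuter_succ hC m L ε ε i,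
      thresholdSaturation_scc hC hid hidm hid hidm⟩
  · rintro _ rfl
    exact ⟨fun ε _ m L i => ⟨bccToSymbol_eq m L ε i, onChain_bccToSymbol_succ m L ε i⟩,
      thresholdSaturation_bcc B hid hidm⟩
  · rintro ρ hρ _ rfl
    exact ⟨fun ε _ m L i => ⟨pccToInfo_upper_eq_lower m L ε _ i, onChain_pccToInfo_succ hC m L ε _ i⟩,
      thresholdSaturation_pcc C hid hidm (fun _ => puncture_mem_Icc hρ) (puncture_mono hρ)⟩
  · rintro ρ₁ hρ₁ ρ₂ hρ₂ _ _ rfl rfl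
    exact ⟨fun ε _ m L i => sccToOuter_succ hC m L _ _ i,
      thresholdSaturation_scc hC (fun _ => puncture_mem_Icc hρ₁) (puncture_mono hρ₁)
        (fun _ => puncture_mem_Icc hρ₂) (puncture_mono hρ₂)⟩
  · rintro ρ hρ _ rfl
    exact ⟨fun ε _ m L i => ⟨bccToSymbol_eq m L _ i, onChain_bccToSymbol_succ m L _ i⟩,
      thresholdSaturation_bcc B (fun _ => puncture_mem_Icc hρ) (puncture_mono hρ)⟩
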